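/- Let $n\ge 1$ and $d\ge 4$ be integers and let $\Sigma$ be an arbitrary $d\times d$ (symmetric) positive definite matrix. Let $\mu=(\mu_1,\dots,\mu_d)^{T}\sim G_0=N_d(0,\Sigma)$ and, given $\mu$, let $Y_{ij}\sim N(\mu_j,1)$ be independent for $i=1,\dots,n$ and $j=1,\dots,d$. Write $\bar Y_j=n^{-1}\sum_{i=1}^n Y_{ij}$ and $\bar Y=d^{-1}\sum_{j=1}^d\bar Y_j$, and consider the estimators $\hat\mu_{HB}$ and $\hat\mu_{PHB}$ of $\mu$ with components $$\hat\mu_{j,HB}=\bar Y+\Big[1-\frac{d-3}{n\sum_{k=1}^d(\bar Y_k-\bar Y)^2}\Big](\bar Y_j-\bar Y),\qquad \hat\mu_{j,PHB}=\Big[1-\frac{d-2}{n\sum_{k=1}^d\bar Y_k^2}\Big]\bar Y_j .$$ For an estimator $\hat\mu$ let $R(\hat\mu,G_0)=\int_{\mathbb R^d}E_{Y\mid\mu}\|\hat\mu-\mu\|_2^2\,dG_0(\mu)$ be its integrated squared $\ell_2$ risk. Let $P$ be a $d\times d$ orthogonal matrix and $\Lambda$ a diagonal matrix with diagonal entries $\lambda_1,\dots,\lambda_d$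 such that $P\Lambda P^{T}=\Sigma$ (so $\lambda_1,\dots,\lambda_d>0$ are the eigenvalues of $\Sigma$), let $1_d$ be the vector in $\mathbb R^d$ with all components equal to $1$, let $Z=P^{T}1_d$, and for $u\in[0,1]$ put $$\xi_1(u)=\Big[1-\frac{n(1-u)}{d}\sum_{j=1}^d\frac{\lambda_jZ_j^2}{1+n(1-u)\lambda_j}\Big]\prod_{j=1}^d\{1+n(1-u)\lambda_j\},\qquad \xi_2(u)=\prod_{j=1}^d\{1+n(1-u)\lambda_j\}.$$ Then $\xi_1$ and $\xi_2$ are positive on $[0,1]$, both integrated risks and the integrals below are finite, and $$R(\hat\mu_{HB},G_0)=\frac dn-\frac{(d-3)^2}{2n}\int_0^1\frac{u^{(d-3)/2-1}}{\sqrt{\xi_1(u)}}\,du,\qquad R(\hat\mu_{PHB},G_0)=\frac dn-\frac{(d-2)^2}{2n}\int_0^1\frac{u^{(d-2)/2-1}}{\sqrt{\xi_2(u)}}\,du .$$ -/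

import Mathlib

open MeasureTheory ProbabilityTheory
open scoped Matrix

noncomputable section

namespace NormalMeans

/-- A data set `Y`: `Y i j` is the `i`-th observation (`i = 1, …, n`) from the `j`-th normal
population (`j = 1, …, d`). -/
abbrev Data (n d : ℕ) : Type := Fin n → Fin d → ℝ

/-- The conditional law of `Y` given `μ`: the `Y i j` are independent, `Y i j ∼ N(μ j, 1)`. -/
def dataLaw (n : ℕ) {d : ℕ} (μ : EuclideanSpace ℝ (Fin d)) : Measure (Data n d) :=
  Measure.pi fun _ : Fin n => Measure.pi fun j : Fin d => gaussianReal (μ j) 1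

/-- The sample mean of the `j`-th population. -/
def popMean {n d : ℕ} (Y : Data n d) (j : Fin d) : ℝ := (∑ i, Y i j) / n

/-- The grand mean. -/
def grandMean {n d : ℕ} (Y : Data n d) : ℝ := (∑ j, popMean Y j) / d

/-- The empirical Bayes estimator of `μ` under the partial-hierarchical Bayes model. -/
def estPHB {n d : ℕ} (Y : Data n d) : EuclideanSpace ℝ (Fin d) :=
  WithLp.toLp 2 fun j =>
    (1 - ((d : ℝ) - 2) / (n * ∑ k, popMean Y k ^ 2)) * popMean Y j

/-- The empirical Bayes estimator of `μ` under the hierarchical Bayes model. -/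
def estHB {n d : ℕ} (Y : Data n d) : EuclideanSpace ℝ (Fin d) :=
  WithLp.toLp 2 fun j =>
    grandMean Y + (1 - ((d : ℝ) - 3) / (n * ∑ k, (popMean Y k - grandMean Y) ^ 2)) *
      (popMean Y j - grandMean Y)

/-- The squared `ℓ²` loss of an estimator. -/
def loss {n d : ℕ} (est : Data n d → EuclideanSpace ℝ (Fin d)) (μ : EuclideanSpace ℝ (Fin d))
    (Y : Data n d) : ℝ :=
  ‖est Y - μ‖ ^ 2

/-- The risk of an estimator at a fixed parameter `μ`. -/
def risk {n d : ℕ} (est : Data n d → EuclideanSpace ℝ (Fin d))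
    (μ : EuclideanSpace ℝ (Fin d)) : ℝ :=
  ∫ Y, loss est μ Y ∂(dataLaw n μ)

/-- The integrated risk of an estimator with respect to a law `G` of the parameter. -/
def integratedRisk {n d : ℕ} (est : Data n d → EuclideanSpace ℝ (Fin d))
    (G : Measure (EuclideanSpace ℝ (Fin d))) : ℝ :=
  ∫ μ, risk est μ ∂G

/-- The expectations that define the integrated risk exist and are finite. -/
def FiniteIntegratedRisk {n d : ℕ} (est : Data n d → EuclideanSpace ℝ (Fin d))
    (G : Measure (EuclideanSpace ℝ (Fin d))) : Prop :=
  (∀ μ, Integrable (loss est μ) (dataLaw n μ)) ∧ Integrable (risk est) G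

/-- `ξ₂(u) = ∏ⱼ (1 + n (1 - u) λⱼ)`. -/
def xi₂ (n : ℕ) {d : ℕ} (lam : Fin d → ℝ) (u : ℝ) : ℝ :=
  ∏ j, (1 + n * (1 - u) * lam j)

/-- `ξ₁(u) = [1 - (n (1 - u) / d) ∑ⱼ λⱼ Zⱼ² / (1 + n (1 - u) λⱼ)] ∏ⱼ (1 + n (1 - u) λⱼ)`. -/
def xi₁ (n : ℕ) {d : ℕ} (lam Z : Fin d → ℝ) (u : ℝ) : ℝ :=
  (1 - n * (1 - u) / d * ∑ j, lam j * Z j ^ 2 / (1 + n * (1 - u) * lam j)) *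
    ∏ j, (1 + n * (1 - u) * lam j)

end NormalMeans

end

open Filter Topology
open scoped NNReal ENNReal RealInnerProductSpace MatrixOrder

/-! Both estimators are James–Stein estimators. In an orthonormal basis `b`, with a set `s` of `r`
indices, they shrink only the coordinates of the sample mean along `b k`, `k ∈ s`, with constant `(r
- 2) / n`. For PHB, `b` is the standard basis and `r = d`. For HB, `b` contains the normalized
vector of ones, `s` omits it, and `r = d - 1`. `IsShrinkage` captures this common form.

Given `μ`, the sample mean is `N(μ, I / n)`. Put `Q = ∑ k ∈ s, ⟪b k, x⟫ ^ 2`. Expanding the loss and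
applying Stein's identity (`integral_sum_sub_mul_div`) gives the risk `d / n - ((r - 2) / n) ^ 2 *
E[1 / Q]`. The identity is proved by integrating over `t` the identities for the bounded weights
`exp (-t Q)`, since `1 / Q = ∫ exp (-t Q) dt`. The same formula bounds `E[1 / Q]` uniformly in `μ`
once `r ≥ 3`, whence finiteness.

Averaging over `μ` turns the law of the mean into `N(0, Σ + I / n)`. If `M` is the matrix of `Q`,
the Laplace transform of `Q` is then `det (1 + 2 t M (Σ + I / n)) ^ (-1/2)`. The substitution `t = n
(1 - u) / (2 u)` moves the integral to `[0, 1]` (`integral_invMoment_eq`), and it remains to see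
that `u ^ r * det (1 + ((1 - u) / u) M (1 + n Σ))` is `ξ`. After conjugation by `P` the matrix is
diagonal for PHB, and a rank-one perturbation of a diagonal matrix for HB. -/

namespace NormalMeans

/-! ### One-dimensional Gaussian integrals and Stein's identity. -/

section OneDim

/-- The Laplace transform of the square of a real Gaussian variable. -/
lemma integral_exp_neg_mul_sq_gaussianReal (m : ℝ) {v : ℝ≥0} (hv : v ≠ 0) {a : ℝ} (ha : 0 ≤ a) :
    ∫ x, Real.exp (-(a * x ^ 2)) ∂(gaussianReal m v) =
      (√(1 + 2 * a * v))⁻¹ * Real.exp (-(a * m ^ 2 / (1 + 2 * a * v))) := by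
  have hv0 : (0 : ℝ) < v := by positivity
  have hp : 0 < 1 + 2 * a * (v : ℝ) := by positivity
  set p : ℝ := 1 + 2 * a * (v : ℝ) with hpdef
  -- Completing the square: `exp (-(a x ^ 2))` times the density of `N(m, v)` is a multiple of the
  -- density of `N(m / p, v / p)`.
  set w : ℝ≥0 := v / p.toNNReal with hw
  have hpN : ((p.toNNReal : ℝ≥0) : ℝ) = p := Real.coe_toNNReal _ hp.le
  have hwv : (w : ℝ) = v / p := by rw [hw]; push_cast; rw [hpN]
  have hw0 : w ≠ 0 := by
    have : (0 : ℝ) < w := by rw [hwv]; positivity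
    exact fun h => by simp [h] at this
  rw [integral_gaussianReal_eq_integral_smul hv]
  have key : ∀ x, gaussianPDFReal m v x • Real.exp (-(a * x ^ 2)) =
      ((√p)⁻¹ * Real.exp (-(a * m ^ 2 / p))) * gaussianPDFReal (m / p) w x := by
    intro x
    rw [gaussianPDFReal_def, gaussianPDFReal_def, smul_eq_mul, hwv]
    have h1 : (√(2 * Real.pi * (v / p)))⁻¹ = √p * (√(2 * Real.pi * v))⁻¹ := by
      rw [← mul_div_assoc, Real.sqrt_div (by positivity), inv_div, div_eq_mul_inv]
    rw [h1]
    have h2 : Real.exp (-(x - m) ^ 2 / (2 * v)) * Real.exp (-(a * x ^ 2)) =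
        Real.exp (-(a * m ^ 2 / p)) * Real.exp (-(x - m / p) ^ 2 / (2 * (v / p))) := by
      rw [← Real.exp_add, ← Real.exp_add]
      congr 1
      field_simp
      rw [hpdef]
      ring
    have hs : √p ≠ 0 := (Real.sqrt_pos.2 hp).ne'
    calc (√(2 * Real.pi * v))⁻¹ * Real.exp (-(x - m) ^ 2 / (2 * v)) * Real.exp (-(a * x ^ 2))
        = (√(2 * Real.pi * v))⁻¹ *
          (Real.exp (-(x - m) ^ 2 / (2 * v)) * Real.exp (-(a * x ^ 2))) := by ring
      _ = _ := by rw [h2]; field_simp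
  simp_rw [key]
  rw [integral_const_mul, integral_gaussianPDFReal_eq_one _ hw0, mul_one]

lemma integral_exp_neg_mul_sq_gaussianReal_le (m : ℝ) {v : ℝ≥0} (hv : v ≠ 0) {a : ℝ}
    (ha : 0 ≤ a) :
    ∫ x, Real.exp (-(a * x ^ 2)) ∂(gaussianReal m v) ≤ (√(1 + 2 * a * v))⁻¹ := by
  rw [integral_exp_neg_mul_sq_gaussianReal m hv ha]
  refine mul_le_of_le_one_right (by positivity) ?_
  rw [Real.exp_le_one_iff, neg_nonpos]
  positivity

lemma hasDerivAt_gaussianPDFReal (m : ℝ) (v : ℝ≥0) (x : ℝ) :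
    HasDerivAt (gaussianPDFReal m v) (-((x - m) / v) * gaussianPDFReal m v x) x := by
  have h : HasDerivAt (fun y : ℝ => -(y - m) ^ 2 / (2 * (v : ℝ))) (-((x - m) / v)) x := by
    have := ((((hasDerivAt_id x).sub_const m).pow 2).neg).div_const (2 * (v : ℝ))
    refine this.congr_deriv ?_
    simp only [id, Nat.cast_ofNat]
    rw [show (2 : ℝ) * (x - m) ^ (2 - 1) * 1 = 2 * (x - m) by norm_num, ← mul_neg,
      mul_div_mul_left _ _ two_ne_zero, neg_div]
  have h2 := (h.exp).const_mul ((√(2 * Real.pi * v))⁻¹)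
  rw [gaussianPDFReal_def]
  refine h2.congr_deriv ?_
  ring

lemma integrable_gaussianReal_iff {m : ℝ} {v : ℝ≥0} (hv : v ≠ 0) {f : ℝ → ℝ} :
    Integrable f (gaussianReal m v) ↔ Integrable (fun x => f x * gaussianPDFReal m v x) := by
  rw [gaussianReal_of_var_ne_zero _ hv,
    integrable_withDensity_iff (measurable_gaussianPDF m v) (by simp [gaussianPDF_lt_top])]
  simp

lemma integrable_pow_gaussianReal (m : ℝ) (v : ℝ≥0) (k : ℕ) :
    Integrable (fun x : ℝ => x ^ k) (gaussianReal m v) := by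
  have := (memLp_id_gaussianReal (μ := m) (v := v) k).integrable_norm_pow'
  refine this.mono' (by fun_prop) ?_
  simp

lemma exp_neg_mul_sq_le_one {a : ℝ} (ha : 0 ≤ a) (x : ℝ) : Real.exp (-(a * x ^ 2)) ≤ 1 := by
  rw [Real.exp_le_one_iff, neg_nonpos]; positivity

lemma integrable_pow_mul_exp_gaussianReal (m : ℝ) (v : ℝ≥0) (k : ℕ) {a : ℝ} (ha : 0 ≤ a) :
    Integrable (fun x : ℝ => x ^ k * Real.exp (-(a * x ^ 2))) (gaussianReal m v) := by
  refine (integrable_pow_gaussianReal m v k).mul_bdd (c := 1) (by fun_prop) (ae_of_all _ fun x => ?_)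
  rw [Real.norm_eq_abs, abs_of_pos (Real.exp_pos _)]
  exact exp_neg_mul_sq_le_one ha x

/-- Stein's identity for `x ↦ x exp (-a x²)`. -/
lemma integral_sub_mul_exp_gaussianReal (m : ℝ) {v : ℝ≥0} (hv : v ≠ 0) {a : ℝ} (ha : 0 ≤ a) :
    ∫ x, (x - m) * x * Real.exp (-(a * x ^ 2)) ∂(gaussianReal m v) =
      v * ∫ x, (1 - 2 * a * x ^ 2) * Real.exp (-(a * x ^ 2)) ∂(gaussianReal m v) := by
  have hv0 : (v : ℝ) ≠ 0 := by exact_mod_cast hv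
  have i0 := integrable_pow_mul_exp_gaussianReal m v 0 ha
  have i1 := integrable_pow_mul_exp_gaussianReal m v 1 ha
  have i2 := integrable_pow_mul_exp_gaussianReal m v 2 ha
  have hu : ∀ x : ℝ, HasDerivAt (fun x : ℝ => x * Real.exp (-(a * x ^ 2)))
      ((1 - 2 * a * x ^ 2) * Real.exp (-(a * x ^ 2))) x := by
    intro x
    have := (hasDerivAt_id x).mul ((((hasDerivAt_id x).pow 2).const_mul a).neg.exp)
    refine this.congr_deriv ?_
    simp
    ring
  have j1 : Integrable (fun x : ℝ => (x - m) * x * Real.exp (-(a * x ^ 2))) (gaussianReal m v) := by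
    refine (i2.sub (i1.const_mul m)).congr (ae_of_all _ fun x => ?_)
    simp; ring
  have j2 : Integrable (fun x : ℝ => (1 - 2 * a * x ^ 2) * Real.exp (-(a * x ^ 2)))
      (gaussianReal m v) := by
    refine (i0.sub (i2.const_mul (2 * a))).congr (ae_of_all _ fun x => ?_)
    simp; ring
  -- Integration by parts against the density, whose derivative is `-(x - m) / v` times itself.
  have ibp := integral_mul_deriv_eq_deriv_mul_of_integrable
    (u := fun x : ℝ => x * Real.exp (-(a * x ^ 2))) (v := gaussianPDFReal m v)
    (fun x _ => hu x) (fun x _ => hasDerivAt_gaussianPDFReal m v x) ?_ ?_ ?_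
  · rw [integral_gaussianReal_eq_integral_smul hv, integral_gaussianReal_eq_integral_smul hv,
      ← integral_const_mul]
    have e1 : ∫ x, x * Real.exp (-(a * x ^ 2)) * (-((x - m) / v) * gaussianPDFReal m v x) =
        -(v : ℝ)⁻¹ * ∫ x, gaussianPDFReal m v x • ((x - m) * x * Real.exp (-(a * x ^ 2))) := by
      rw [← integral_const_mul]
      congr 1 with x
      simp only [smul_eq_mul]; field_simp
    have e2 : ∫ x, (v : ℝ) * (gaussianPDFReal m v x •
        ((1 - 2 * a * x ^ 2) * Real.exp (-(a * x ^ 2)))) =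
        (v : ℝ) * ∫ x, (1 - 2 * a * x ^ 2) * Real.exp (-(a * x ^ 2)) * gaussianPDFReal m v x := by
      rw [← integral_const_mul]
      congr 1 with x
      simp only [smul_eq_mul]; ring
    rw [e1] at ibp
    rw [e2]
    rw [neg_mul, neg_inj, inv_mul_eq_iff_eq_mul₀ hv0] at ibp
    exact ibp
  · refine ((integrable_gaussianReal_iff hv).1 (j1.const_mul (-(v : ℝ)⁻¹))).congr
      (ae_of_all _ fun x => ?_)
    simp only [Pi.mul_apply]; field_simp
  · exact (integrable_gaussianReal_iff hv).1 j2
  · refine ((integrable_gaussianReal_iff hv).1 i1).congr (ae_of_all _ fun x => ?_)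
    simp

end OneDim

/-! ### Independent Gaussian coordinates: exponential weights in a partial sum of squares. -/

section Product

variable {ι : Type*} [Fintype ι] (m : ι → ℝ) {v : ℝ≥0} (s : Finset ι)

/-- Coordinates outside `s` get rate `0`, so that the product runs over the whole index type and
integrals against the product measure factor. -/
lemma exp_neg_mul_sum_sq_eq_prod [DecidableEq ι] (t : ℝ) (y : ι → ℝ) :
    Real.exp (-(t * ∑ k ∈ s, y k ^ 2)) =
      ∏ k, Real.exp (-((if k ∈ s then t else 0) * y k ^ 2)) := by
  rw [← Real.exp_sum, Finset.sum_neg_distrib, Finset.mul_sum]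
  simp [ite_mul, Finset.sum_ite_mem]

omit [Fintype ι] in
lemma exp_neg_mul_sum_sq_le_one {t : ℝ} (ht : 0 ≤ t) (y : ι → ℝ) :
    Real.exp (-(t * ∑ k ∈ s, y k ^ 2)) ≤ 1 := by
  rw [Real.exp_le_one_iff, neg_nonpos]
  exact mul_nonneg ht (Finset.sum_nonneg fun k _ => sq_nonneg _)

/-- The Laplace transform of a partial sum of squares of independent Gaussian variables is at most
that of the centred case. -/
lemma integral_exp_neg_mul_sum_sq_le (hv : v ≠ 0) {t : ℝ} (ht : 0 ≤ t) :
    ∫ y, Real.exp (-(t * ∑ k ∈ s, y k ^ 2)) ∂(Measure.pi fun k => gaussianReal (m k) v) ≤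
      (1 + 2 * t * v) ^ (-(s.card : ℝ) / 2) := by
  classical
  simp_rw [exp_neg_mul_sum_sq_eq_prod]
  rw [integral_fintype_prod_eq_prod
    (f := fun k x => Real.exp (-((if k ∈ s then t else 0) * x ^ 2)))]
  have hp : 0 < 1 + 2 * t * (v : ℝ) := by positivity
  calc _ ≤ ∏ k, (√(1 + 2 * (if k ∈ s then t else 0) * v))⁻¹ := by
        refine Finset.prod_le_prod (fun k _ => integral_nonneg fun _ => (Real.exp_pos _).le)
          fun k _ => integral_exp_neg_mul_sq_gaussianReal_le (m k) hv (by split_ifs <;> simp [ht])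
    _ = ∏ k, (if k ∈ s then (√(1 + 2 * t * v))⁻¹ else 1) := by
        refine Finset.prod_congr rfl fun k _ => ?_
        split_ifs <;> simp
    _ = (√(1 + 2 * t * v))⁻¹ ^ s.card := by
        rw [Finset.prod_ite_mem, Finset.univ_inter, Finset.prod_const]
    _ = _ := by
        rw [Real.sqrt_eq_rpow, ← Real.rpow_neg hp.le, ← Real.rpow_natCast, ← Real.rpow_mul hp.le]
        congr 1; ring

/-- The weight is a product, so the coordinates other than `k` contribute the same factor to both
sides; what remains is the one-dimensional identity. -/
lemma integral_coord_sub_mul_exp [DecidableEq ι] (hv : v ≠ 0) {t : ℝ} (ht : 0 ≤ t) {k : ι}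
    (hk : k ∈ s) :
    ∫ y, (y k - m k) * y k * Real.exp (-(t * ∑ k ∈ s, y k ^ 2))
        ∂(Measure.pi fun k => gaussianReal (m k) v) =
      v * ∫ y, (1 - 2 * t * y k ^ 2) * Real.exp (-(t * ∑ k ∈ s, y k ^ 2))
        ∂(Measure.pi fun k => gaussianReal (m k) v) := by
  have key : ∀ g : ℝ → ℝ, ∫ y, g (y k) * Real.exp (-(t * ∑ k ∈ s, y k ^ 2))
        ∂(Measure.pi fun k => gaussianReal (m k) v) =
      (∫ x, g x * Real.exp (-(t * x ^ 2)) ∂(gaussianReal (m k) v)) *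
        ∏ j ∈ Finset.univ.erase k, ∫ x, Real.exp (-((if j ∈ s then t else 0) * x ^ 2))
          ∂(gaussianReal (m j) v) := by
    intro g
    have : ∀ y : ι → ℝ, g (y k) * Real.exp (-(t * ∑ k ∈ s, y k ^ 2)) =
        ∏ j, ((if j = k then g (y j) else 1) *
          Real.exp (-((if j ∈ s then t else 0) * y j ^ 2))) := by
      intro y
      rw [Finset.prod_mul_distrib, ← exp_neg_mul_sum_sq_eq_prod]
      simp
    simp_rw [this]
    rw [integral_fintype_prod_eq_prod (f := fun j x => (if j = k then g x else 1) *
      Real.exp (-((if j ∈ s then t else 0) * x ^ 2))),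
      ← Finset.mul_prod_erase _ _ (Finset.mem_univ k)]
    congr 1
    · simp [hk]
    · refine Finset.prod_congr rfl fun j hj => ?_
      simp [Finset.ne_of_mem_erase hj]
  rw [key (fun x => (x - m k) * x), key (fun x => 1 - 2 * t * x ^ 2),
    integral_sub_mul_exp_gaussianReal (m k) hv ht, mul_assoc]

lemma memLp_coord (k : ι) :
    MemLp (fun y : ι → ℝ => y k) 2 (Measure.pi fun k => gaussianReal (m k) v) :=
  (memLp_id_gaussianReal 2).comp_measurePreserving
    (measurePreserving_eval (fun k => gaussianReal (m k) v) k)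

lemma memLp_coord_sub (k : ι) :
    MemLp (fun y : ι → ℝ => y k - m k) 2 (Measure.pi fun k => gaussianReal (m k) v) :=
  (memLp_coord m k).sub (memLp_const _)

lemma integrable_mul_exp_neg {f : (ι → ℝ) → ℝ}
    (hf : Integrable f (Measure.pi fun k => gaussianReal (m k) v)) {t : ℝ} (ht : 0 ≤ t) :
    Integrable (fun y => f y * Real.exp (-(t * ∑ k ∈ s, y k ^ 2)))
      (Measure.pi fun k => gaussianReal (m k) v) := by
  refine hf.mul_bdd (c := 1) (Measurable.aestronglyMeasurable (by fun_prop)) (ae_of_all _ fun y => ?_)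
  rw [Real.norm_eq_abs, abs_of_pos (Real.exp_pos _)]
  exact exp_neg_mul_sum_sq_le_one s ht y

/-- Stein's identity for the vector field `y ↦ exp (-t |y_s|²) y_s`. -/
lemma integral_sum_sub_mul_exp (hv : v ≠ 0) {t : ℝ} (ht : 0 ≤ t) :
    ∫ y, (∑ k ∈ s, (y k - m k) * y k) * Real.exp (-(t * ∑ k ∈ s, y k ^ 2))
        ∂(Measure.pi fun k => gaussianReal (m k) v) =
      v * ∫ y, (s.card - 2 * t * ∑ k ∈ s, y k ^ 2) * Real.exp (-(t * ∑ k ∈ s, y k ^ 2))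
        ∂(Measure.pi fun k => gaussianReal (m k) v) := by
  classical
  have h1 : ∀ y : ι → ℝ, ((s.card : ℝ) - 2 * t * ∑ k ∈ s, y k ^ 2) *
      Real.exp (-(t * ∑ k ∈ s, y k ^ 2)) =
      ∑ k ∈ s, (1 - 2 * t * y k ^ 2) * Real.exp (-(t * ∑ k ∈ s, y k ^ 2)) := by
    intro y
    rw [← Finset.sum_mul, Finset.sum_sub_distrib, Finset.mul_sum]
    simp
  simp_rw [h1]
  rw [integral_finsetSum, Finset.mul_sum]
  · simp_rw [Finset.sum_mul]
    rw [integral_finsetSum]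
    · exact Finset.sum_congr rfl fun k hk => integral_coord_sub_mul_exp m s hv ht hk
    · exact fun k _ => integrable_mul_exp_neg m s
        ((memLp_coord_sub m k).integrable_mul (memLp_coord m k)) ht
  · exact fun k _ => integrable_mul_exp_neg m s
      ((integrable_const _).sub ((memLp_coord m k).integrable_sq.const_mul _)) ht

/-- The Laplace formula for the inverse fails where the sum vanishes. A single coordinate in `s`
suffices to exclude this, since a nondegenerate Gaussian has no atoms. -/
lemma ae_sum_sq_pos (hv : v ≠ 0) (hs : s.Nonempty) :
    ∀ᵐ y ∂(Measure.pi fun k => gaussianReal (m k) v), 0 < ∑ k ∈ s, y k ^ 2 := by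
  obtain ⟨k, hk⟩ := hs
  have h0 : ∀ᵐ x ∂(gaussianReal (m k) v), x ≠ 0 := by
    have := nullSingletonClass_gaussianReal (μ := m k) hv
    simp [ae_iff]
  have := (measurePreserving_eval (fun k => gaussianReal (m k) v) k).quasiMeasurePreserving.ae h0
  filter_upwards [this] with y hy
  exact Finset.sum_pos' (fun _ _ => sq_nonneg _) ⟨k, hk, by simpa using sq_pos_of_ne_zero hy⟩

end Product

/-! ### Laplace representations of inverse powers. -/

section Laplace

lemma integral_exp_neg_mul_Ioi {q : ℝ} (hq : 0 < q) :
    ∫ t in Set.Ioi (0 : ℝ), Real.exp (-(t * q)) = q⁻¹ := by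
  have := Real.integral_rpow_mul_exp_neg_mul_Ioi (a := 1) one_pos hq
  simpa [mul_comm q] using this

lemma integral_mul_exp_neg_mul_Ioi {q : ℝ} (hq : 0 < q) :
    ∫ t in Set.Ioi (0 : ℝ), t * Real.exp (-(t * q)) = (q ^ 2)⁻¹ := by
  have := Real.integral_rpow_mul_exp_neg_mul_Ioi (a := 2) two_pos hq
  rw [show (2 : ℝ) - 1 = 1 by norm_num] at this
  simpa [mul_comm q, Real.Gamma_two] using this

lemma integrableOn_exp_neg_mul_Ioi {q : ℝ} (hq : 0 < q) :
    IntegrableOn (fun t => Real.exp (-(t * q))) (Set.Ioi (0 : ℝ)) := by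
  -- A non-integrable function has Bochner integral `0`, but the known value is positive.
  by_contra h
  have := integral_exp_neg_mul_Ioi hq
  rw [integral_undef h] at this
  exact (inv_pos.2 hq).ne this

lemma integrableOn_mul_exp_neg_mul_Ioi {q : ℝ} (hq : 0 < q) :
    IntegrableOn (fun t => t * Real.exp (-(t * q))) (Set.Ioi (0 : ℝ)) := by
  by_contra h
  have := integral_mul_exp_neg_mul_Ioi hq
  rw [integral_undef h] at this
  exact (inv_pos.2 (pow_pos hq 2)).ne this

/-- Since `h ≥ 0`, the inner `L¹` norm is `|g| ∫ h`, so integrability on the product reduces to that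
of `g ∫ h`. This justifies the exchanges of integrals in Stein's identity for `y / |y|²`. -/
lemma integrable_prod_mul_of_nonneg {α : Type*} {mα : MeasurableSpace α} {ν : Measure α}
    [SFinite ν] {g q : α → ℝ} (hg : Measurable g) (hq : Measurable q) {h : ℝ → ℝ → ℝ}
    (hm : Measurable (Function.uncurry h)) (h0 : ∀ t > 0, ∀ x, 0 ≤ h t x)
    (hi : ∀ᵐ y ∂ν, IntegrableOn (fun t => h t (q y)) (Set.Ioi (0 : ℝ)))
    (hgi : Integrable (fun y => g y * ∫ t in Set.Ioi (0 : ℝ), h t (q y)) ν) :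
    Integrable (fun p : α × ℝ => g p.1 * h p.2 (q p.1))
      (ν.prod (volume.restrict (Set.Ioi (0 : ℝ)))) := by
  have hmeas : Measurable (fun p : α × ℝ => g p.1 * h p.2 (q p.1)) :=
    (hg.comp measurable_fst).mul
      (hm.comp (measurable_snd.prodMk (hq.comp measurable_fst)))
  rw [integrable_prod_iff hmeas.aestronglyMeasurable]
  refine ⟨?_, hgi.norm.congr (ae_of_all _ fun y => ?_)⟩
  · filter_upwards [hi] with y hy
    exact hy.const_mul (g y)
  · have e : ∀ t ∈ Set.Ioi (0 : ℝ), ‖g y * h t (q y)‖ = ‖g y‖ * h t (q y) := fun t ht => by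
      rw [norm_mul, Real.norm_of_nonneg (h0 t ht _)]
    change ‖g y * ∫ t in Set.Ioi (0 : ℝ), h t (q y)‖ = ∫ t in Set.Ioi (0 : ℝ), ‖g y * h t (q y)‖
    rw [setIntegral_congr_fun measurableSet_Ioi e, integral_const_mul, norm_mul,
      Real.norm_of_nonneg (setIntegral_nonneg measurableSet_Ioi fun t ht => h0 t ht _)]

end Laplace

/-! ### Inverse moments and the James–Stein risk in coordinates. -/

section InverseMoment

variable {ι : Type*} [Fintype ι] (m : ι → ℝ) {v : ℝ≥0} (s : Finset ι)

/-- Tonelli applied to `1 / Q = ∫ exp (-t Q) dt`. The bound does not depend on `m`, which later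
makes the inverse moment integrable against any finite law of the means. -/
lemma lintegral_inv_sum_sq_le (hv : v ≠ 0) (hs : 3 ≤ s.card) :
    ∫⁻ y, ENNReal.ofReal (∑ k ∈ s, y k ^ 2)⁻¹ ∂(Measure.pi fun k => gaussianReal (m k) v) ≤
      ENNReal.ofReal (∫ t in Set.Ioi (0 : ℝ), (1 + 2 * t * v) ^ (-(s.card : ℝ) / 2)) := by
  have hv0 : (0 : ℝ) < v := by positivity
  have hne : s.Nonempty := Finset.card_pos.1 (by omega)
  have hint : IntegrableOn (fun t : ℝ => (1 + 2 * t * (v : ℝ)) ^ (-(s.card : ℝ) / 2))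
      (Set.Ioi 0) := by
    -- Three coordinates make the exponent less than `-1`, hence integrable at infinity.
    have h1 : IntegrableOn (fun t : ℝ => (t + (2 * v : ℝ)⁻¹) ^ (-(s.card : ℝ) / 2)) (Set.Ioi 0) :=
      integrableOn_add_rpow_Ioi_of_lt (by
        have : (3 : ℝ) ≤ s.card := by exact_mod_cast hs
        linarith) (by simpa using hv0)
    refine IntegrableOn.congr_fun (h1.const_mul ((2 * v : ℝ) ^ (-(s.card : ℝ) / 2)))
      (fun t ht => ?_) measurableSet_Ioi
    have : (0 : ℝ) < t := ht
    change _ * _ = _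
    rw [← Real.mul_rpow (by positivity) (by positivity)]
    congr 1
    field_simp
    ring
  calc ∫⁻ y, ENNReal.ofReal (∑ k ∈ s, y k ^ 2)⁻¹ ∂(Measure.pi fun k => gaussianReal (m k) v)
      = ∫⁻ y, (∫⁻ t in Set.Ioi (0 : ℝ), ENNReal.ofReal (Real.exp (-(t * ∑ k ∈ s, y k ^ 2))))
          ∂(Measure.pi fun k => gaussianReal (m k) v) := by
        refine lintegral_congr_ae ?_
        filter_upwards [ae_sum_sq_pos m s hv hne] with y hy
        rw [← integral_exp_neg_mul_Ioi hy,
          ofReal_integral_eq_lintegral_ofReal (integrableOn_exp_neg_mul_Ioi hy)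
            (ae_of_all _ fun _ => (Real.exp_pos _).le)]
    _ = ∫⁻ t in Set.Ioi (0 : ℝ), ∫⁻ y, ENNReal.ofReal (Real.exp (-(t * ∑ k ∈ s, y k ^ 2)))
          ∂(Measure.pi fun k => gaussianReal (m k) v) := by
        refine lintegral_lintegral_swap (Measurable.aemeasurable ?_)
        change Measurable fun p : (ι → ℝ) × ℝ =>
          ENNReal.ofReal (Real.exp (-(p.2 * ∑ k ∈ s, p.1 k ^ 2)))
        fun_prop
    _ ≤ ∫⁻ t in Set.Ioi (0 : ℝ), ENNReal.ofReal ((1 + 2 * t * v) ^ (-(s.card : ℝ) / 2)) := by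
        refine setLIntegral_mono' measurableSet_Ioi fun t ht => ?_
        have ht0 : (0 : ℝ) ≤ t := (Set.mem_Ioi.1 ht).le
        have h1 := integrable_mul_exp_neg m (v := v) s (integrable_const (1 : ℝ)) ht0
        simp only [one_mul] at h1
        rw [← ofReal_integral_eq_lintegral_ofReal h1
          (ae_of_all _ fun _ => (Real.exp_pos _).le)]
        exact ENNReal.ofReal_le_ofReal (integral_exp_neg_mul_sum_sq_le m s hv ht0)
    _ = _ := by
        rw [ofReal_integral_eq_lintegral_ofReal hint]
        filter_upwards [ae_restrict_mem measurableSet_Ioi] with t ht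
        have : (0 : ℝ) < t := ht
        change 0 ≤ _
        positivity

lemma integrable_inv_sum_sq (hv : v ≠ 0) (hs : 3 ≤ s.card) :
    Integrable (fun y : ι → ℝ => (∑ k ∈ s, y k ^ 2)⁻¹)
      (Measure.pi fun k => gaussianReal (m k) v) := by
  refine ⟨Measurable.aestronglyMeasurable (by fun_prop), ?_⟩
  rw [hasFiniteIntegral_iff_ofReal (ae_of_all _ fun y => inv_nonneg.2
    (Finset.sum_nonneg fun _ _ => sq_nonneg _))]
  exact (lintegral_inv_sum_sq_le m s hv hs).trans_lt ENNReal.ofReal_lt_top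

lemma integral_inv_sum_sq_le (hv : v ≠ 0) (hs : 3 ≤ s.card) :
    ∫ y, (∑ k ∈ s, y k ^ 2)⁻¹ ∂(Measure.pi fun k => gaussianReal (m k) v) ≤
      ∫ t in Set.Ioi (0 : ℝ), (1 + 2 * t * v) ^ (-(s.card : ℝ) / 2) := by
  have h := lintegral_inv_sum_sq_le m s hv hs
  rw [← ofReal_integral_eq_lintegral_ofReal (integrable_inv_sum_sq m s hv hs)
    (ae_of_all _ fun y => inv_nonneg.2 (Finset.sum_nonneg fun _ _ => sq_nonneg _))] at h
  refine (ENNReal.ofReal_le_ofReal_iff (setIntegral_nonneg measurableSet_Ioi fun t ht => ?_)).1 h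
  have : (0 : ℝ) < t := ht
  positivity

/-- With `A = ∑ (y k - m k) ^ 2` over `s`, Cauchy–Schwarz and the arithmetic-geometric mean
inequality bound the function by `√(A / Q) ≤ (A + 1 / Q) / 2`. -/
lemma integrable_sum_sub_mul_div (hv : v ≠ 0) (hs : 3 ≤ s.card) :
    Integrable (fun y : ι → ℝ => (∑ k ∈ s, (y k - m k) * y k) * (∑ k ∈ s, y k ^ 2)⁻¹)
      (Measure.pi fun k => gaussianReal (m k) v) := by
  have hne : s.Nonempty := Finset.card_pos.1 (by omega)
  have hA : Integrable (fun y : ι → ℝ => ∑ k ∈ s, (y k - m k) ^ 2)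
      (Measure.pi fun k => gaussianReal (m k) v) :=
    integrable_finsetSum _ fun k _ => (memLp_coord_sub m k).integrable_sq
  refine ((hA.add (integrable_inv_sum_sq m s hv hs)).div_const 2).mono'
    (Measurable.aestronglyMeasurable (by fun_prop)) ?_
  filter_upwards [ae_sum_sq_pos m s hv hne] with y hy
  have hcs := Finset.sum_mul_sq_le_sq_mul_sq s (fun k => y k - m k) (fun k => y k)
  have hA0 : 0 ≤ ∑ k ∈ s, (y k - m k) ^ 2 := Finset.sum_nonneg fun _ _ => sq_nonneg _
  simp only [Pi.add_apply]
  generalize ∑ k ∈ s, (y k - m k) ^ 2 = A at *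
  generalize ∑ k ∈ s, y k ^ 2 = Q at *
  generalize ∑ k ∈ s, (y k - m k) * y k = g at *
  rw [Real.norm_eq_abs]
  refine abs_le_of_sq_le_sq ?_ (by positivity)
  calc (g * Q⁻¹) ^ 2 = g ^ 2 * Q⁻¹ ^ 2 := by ring
    _ ≤ A * Q * Q⁻¹ ^ 2 := by gcongr
    _ = A * Q⁻¹ := by field_simp
    _ ≤ ((A + Q⁻¹) / 2) ^ 2 := by nlinarith [sq_nonneg (A - Q⁻¹)]

/-- Stein's identity for the vector field `y ↦ y_s / |y_s|²`. -/
lemma integral_sum_sub_mul_div (hv : v ≠ 0) (hs : 3 ≤ s.card) :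
    ∫ y, (∑ k ∈ s, (y k - m k) * y k) * (∑ k ∈ s, y k ^ 2)⁻¹
        ∂(Measure.pi fun k => gaussianReal (m k) v) =
      v * (s.card - 2) * ∫ y, (∑ k ∈ s, y k ^ 2)⁻¹
        ∂(Measure.pi fun k => gaussianReal (m k) v) := by
  have hne : s.Nonempty := Finset.card_pos.1 (by omega)
  have hpos := ae_sum_sq_pos m s hv hne
  have hI := integrable_inv_sum_sq m s hv hs
  have hG := integrable_sum_sub_mul_div m s hv hs
  set ν := Measure.pi fun k => gaussianReal (m k) v
  set Q : (ι → ℝ) → ℝ := fun y => ∑ k ∈ s, y k ^ 2 with hQ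
  set g : (ι → ℝ) → ℝ := fun y => ∑ k ∈ s, (y k - m k) * y k with hg
  have hQm : Measurable Q := by fun_prop
  have hgm : Measurable g := by fun_prop
  have m1 : Measurable (Function.uncurry fun t q : ℝ => Real.exp (-(t * q))) := by
    unfold Function.uncurry; fun_prop
  have m2 : Measurable (Function.uncurry fun t q : ℝ => t * Real.exp (-(t * q))) := by
    unfold Function.uncurry; fun_prop
  have e1 : ∀ᵐ y ∂ν, ∫ t in Set.Ioi (0 : ℝ), Real.exp (-(t * Q y)) = (Q y)⁻¹ := by
    filter_upwards [hpos] with y hy using integral_exp_neg_mul_Ioi hy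
  have e2 : ∀ᵐ y ∂ν, ∫ t in Set.Ioi (0 : ℝ), t * Real.exp (-(t * Q y)) = (Q y ^ 2)⁻¹ := by
    filter_upwards [hpos] with y hy using integral_mul_exp_neg_mul_Ioi hy
  have i1 : ∀ᵐ y ∂ν, IntegrableOn (fun t => Real.exp (-(t * Q y))) (Set.Ioi 0) := by
    filter_upwards [hpos] with y hy using integrableOn_exp_neg_mul_Ioi hy
  have i2 : ∀ᵐ y ∂ν, IntegrableOn (fun t => t * Real.exp (-(t * Q y))) (Set.Ioi 0) := by
    filter_upwards [hpos] with y hy using integrableOn_mul_exp_neg_mul_Ioi hy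
  have F1 : Integrable (fun p : (ι → ℝ) × ℝ => g p.1 * Real.exp (-(p.2 * Q p.1)))
      (ν.prod (volume.restrict (Set.Ioi (0 : ℝ)))) := by
    refine integrable_prod_mul_of_nonneg hgm hQm (h := fun t q => Real.exp (-(t * q))) m1
      (fun _ _ _ => (Real.exp_pos _).le) i1 (hG.congr ?_)
    filter_upwards [e1] with y hy
    rw [hy]
  have F2 : Integrable (fun p : (ι → ℝ) × ℝ => (s.card : ℝ) * Real.exp (-(p.2 * Q p.1)))
      (ν.prod (volume.restrict (Set.Ioi (0 : ℝ)))) := by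
    refine integrable_prod_mul_of_nonneg (measurable_const) hQm
      (h := fun t q => Real.exp (-(t * q))) m1
      (fun _ _ _ => (Real.exp_pos _).le) i1 ((hI.const_mul (s.card : ℝ)).congr ?_)
    filter_upwards [e1] with y hy
    rw [hy]
  have F3 : Integrable (fun p : (ι → ℝ) × ℝ => (2 * Q p.1) * (p.2 * Real.exp (-(p.2 * Q p.1))))
      (ν.prod (volume.restrict (Set.Ioi (0 : ℝ)))) := by
    refine integrable_prod_mul_of_nonneg (hQm.const_mul 2) hQm
      (h := fun t q => t * Real.exp (-(t * q))) m2
      (fun t ht _ => mul_nonneg (le_of_lt ht) (Real.exp_pos _).le) i2 ((hI.const_mul 2).congr ?_)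
    filter_upwards [e2, hpos] with y hy hy0
    rw [hy]
    have : Q y ≠ 0 := hy0.ne'
    change 2 * (Q y)⁻¹ = _
    field_simp
  -- Integrate Stein's identity for `exp (-t Q) y` over `t`: `(r - 2 t Q) exp (-t Q)` integrates to
  -- `r / Q - 2 Q / Q ^ 2 = (r - 2) / Q`.
  calc ∫ y, g y * (Q y)⁻¹ ∂ν
      = ∫ y, (∫ t in Set.Ioi (0 : ℝ), g y * Real.exp (-(t * Q y))) ∂ν := by
        refine integral_congr_ae ?_
        filter_upwards [e1] with y hy
        rw [integral_const_mul, hy]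
    _ = ∫ t in Set.Ioi (0 : ℝ), ∫ y, g y * Real.exp (-(t * Q y)) ∂ν := integral_integral_swap F1
    _ = ∫ t in Set.Ioi (0 : ℝ), v * ∫ y, (s.card * Real.exp (-(t * Q y)) -
          (2 * Q y) * (t * Real.exp (-(t * Q y)))) ∂ν := by
        refine setIntegral_congr_fun measurableSet_Ioi fun t ht => ?_
        have := integral_sum_sub_mul_exp m s hv (le_of_lt ht)
        rw [this]
        congr 2 with y
        simp only [hQ]; ring
    _ = v * ∫ t in Set.Ioi (0 : ℝ), ∫ y, (s.card * Real.exp (-(t * Q y)) -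
          (2 * Q y) * (t * Real.exp (-(t * Q y)))) ∂ν := integral_const_mul _ _
    _ = v * ∫ y, (∫ t in Set.Ioi (0 : ℝ), (s.card * Real.exp (-(t * Q y)) -
          (2 * Q y) * (t * Real.exp (-(t * Q y))))) ∂ν := by
        exact congrArg _ (integral_integral_swap (F2.sub F3)).symm
    _ = v * ∫ y, (s.card - 2) * (Q y)⁻¹ ∂ν := by
        congr 1
        refine integral_congr_ae ?_
        filter_upwards [e1, e2, i1, i2, hpos] with y h1 h2 h3 h4 h5
        rw [integral_sub (h3.const_mul _) (h4.const_mul _), integral_const_mul,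
          integral_const_mul, h1, h2]
        have : Q y ≠ 0 := h5.ne'
        field_simp
    _ = _ := by rw [integral_const_mul, mul_assoc]

variable [DecidableEq ι]

/-- The squared loss of the James–Stein estimator that shrinks the coordinates in `s`. -/
lemma sum_shrink_sub_sq (c : ℝ) (y : ι → ℝ) :
    ∑ k, (y k - (if k ∈ s then c / (∑ j ∈ s, y j ^ 2) * y k else 0) - m k) ^ 2 =
      ∑ k, (y k - m k) ^ 2 -
        2 * c * ((∑ k ∈ s, (y k - m k) * y k) * (∑ k ∈ s, y k ^ 2)⁻¹) +
        c ^ 2 * (∑ k ∈ s, y k ^ 2)⁻¹ := by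
  set Q := ∑ j ∈ s, y j ^ 2 with hQ
  have h : ∀ k, (y k - (if k ∈ s then c / Q * y k else 0) - m k) ^ 2 =
      (y k - m k) ^ 2 + if k ∈ s then
        (-(2 * c * Q⁻¹) * ((y k - m k) * y k) + (c * Q⁻¹) ^ 2 * y k ^ 2) else 0 := by
    intro k
    split_ifs <;> ring
  simp_rw [h]
  rw [Finset.sum_add_distrib, Finset.sum_ite_mem, Finset.univ_inter, Finset.sum_add_distrib,
    ← Finset.mul_sum, ← Finset.mul_sum, ← hQ]
  -- The convention `0⁻¹ = 0` makes this hold at `Q = 0` too, so the expansion needs no exceptional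
  -- set.
  have : (c * Q⁻¹) ^ 2 * Q = c ^ 2 * Q⁻¹ := by
    rcases eq_or_ne Q 0 with h0 | h0
    · simp [h0]
    · field_simp
  rw [this]; ring

lemma integrable_sum_shrink_sub_sq (hv : v ≠ 0) (hs : 3 ≤ s.card) (c : ℝ) :
    Integrable (fun y : ι → ℝ =>
      ∑ k, (y k - (if k ∈ s then c / (∑ j ∈ s, y j ^ 2) * y k else 0) - m k) ^ 2)
      (Measure.pi fun k => gaussianReal (m k) v) := by
  simp_rw [sum_shrink_sub_sq]
  exact ((integrable_finsetSum _ fun k _ => (memLp_coord_sub m k).integrable_sq).sub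
    ((integrable_sum_sub_mul_div m s hv hs).const_mul _)).add
    ((integrable_inv_sum_sq m s hv hs).const_mul _)

omit [DecidableEq ι] in
lemma integral_coord_sub_sq (k : ι) :
    ∫ y, (y k - m k) ^ 2 ∂(Measure.pi fun k => gaussianReal (m k) v) = v := by
  have h := (measurePreserving_eval (fun k => gaussianReal (m k) v) k)
  have e : ∫ y, (y k - m k) ^ 2 ∂(Measure.pi fun k => gaussianReal (m k) v) =
      ∫ x, (x - m k) ^ 2 ∂(gaussianReal (m k) v) := by
    rw [← h.map_eq, integral_map h.measurable.aemeasurable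
      (Measurable.aestronglyMeasurable (by fun_prop))]
  rw [e]
  have h2 := variance_fun_id_gaussianReal (μ := m k) (v := v)
  rw [variance_eq_integral (by fun_prop)] at h2
  simpa using h2

/-- The risk of the James–Stein estimator that shrinks the coordinates in `s`. -/
lemma integral_sum_shrink_sub_sq (hv : v ≠ 0) (hs : 3 ≤ s.card) :
    ∫ y, ∑ k, (y k - (if k ∈ s then (v * (s.card - 2)) / (∑ j ∈ s, y j ^ 2) * y k else 0)
        - m k) ^ 2 ∂(Measure.pi fun k => gaussianReal (m k) v) =
      Fintype.card ι * v - (v * (s.card - 2)) ^ 2 *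
        ∫ y, (∑ k ∈ s, y k ^ 2)⁻¹ ∂(Measure.pi fun k => gaussianReal (m k) v) := by
  have j1 : Integrable (fun y : ι → ℝ => ∑ k, (y k - m k) ^ 2)
      (Measure.pi fun k => gaussianReal (m k) v) :=
    integrable_finsetSum _ fun k _ => (memLp_coord_sub m k).integrable_sq
  have j2 := (integrable_sum_sub_mul_div m s hv hs).const_mul (2 * (v * (s.card - 2) : ℝ))
  have j3 := (integrable_inv_sum_sq m s hv hs).const_mul ((v * (s.card - 2) : ℝ) ^ 2)
  simp_rw [sum_shrink_sub_sq]
  refine (integral_add (j1.sub j2) j3).trans ?_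
  refine (congrArg₂ _ (integral_sub j1 j2) rfl).trans ?_
  -- For `c = v (r - 2)`, Stein's identity makes the cross term `-2 c ^ 2 E[1 / Q]`, which combines
  -- with `c ^ 2 E[1 / Q]`.
  rw [integral_const_mul, integral_const_mul, integral_sum_sub_mul_div m s hv hs, integral_finsetSum _
      fun k _ => (memLp_coord_sub m k).integrable_sq]
  simp_rw [integral_coord_sub_sq]
  simp
  ring

end InverseMoment

/-! ### The law of the sample mean and its invariance under rotations. -/

section Law

variable {ι : Type*} [Fintype ι] [DecidableEq ι]

omit [Fintype ι] in
lemma posSemidef_smul_one (v : ℝ≥0) : ((v : ℝ) • (1 : Matrix ι ι ℝ)).PosSemidef :=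
  Matrix.PosSemidef.one.smul v.2

lemma charFun_multivariateGaussian_smul_one (μ : EuclideanSpace ℝ ι) (v : ℝ≥0)
    (t : EuclideanSpace ℝ ι) :
    charFun (multivariateGaussian μ ((v : ℝ) • 1)) t =
      Complex.exp (⟪t, μ⟫ * Complex.I - (v * ‖t‖ ^ 2 : ℝ) / 2) := by
  rw [charFun_multivariateGaussian (posSemidef_smul_one v)]
  congr 2
  rw [EuclideanSpace.real_norm_sq_eq, Matrix.smul_mulVec, Matrix.one_mulVec, dotProduct_smul]
  simp [dotProduct, pow_two]

lemma map_toLp_pi_gaussianReal (m : ι → ℝ) (v : ℝ≥0) :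
    (Measure.pi fun k => gaussianReal (m k) v).map (WithLp.toLp 2) =
      multivariateGaussian (WithLp.toLp 2 m) ((v : ℝ) • 1) := by
  apply Measure.ext_of_charFun (E := EuclideanSpace ℝ ι)
  ext t
  rw [charFun_multivariateGaussian_smul_one, charFun_pi]
  simp_rw [charFun_gaussianReal]
  rw [← Complex.exp_sum]
  congr 1
  rw [EuclideanSpace.real_norm_sq_eq, Finset.sum_sub_distrib, ← Finset.sum_mul]
  simp [PiLp.inner_apply, Finset.mul_sum, Finset.sum_div, mul_comm]

lemma map_repr_multivariateGaussian (b : OrthonormalBasis ι ℝ (EuclideanSpace ℝ ι))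
    (μ : EuclideanSpace ℝ ι) (v : ℝ≥0) :
    (multivariateGaussian μ ((v : ℝ) • 1)).map b.repr =
      multivariateGaussian (b.repr μ) ((v : ℝ) • 1) := by
  apply Measure.ext_of_charFun (E := EuclideanSpace ℝ ι)
  ext t
  have h : ∀ x, ⟪b.repr x, t⟫ = ⟪x, b.repr.symm t⟫ := fun x => by
    rw [← b.repr.inner_map_map x, LinearIsometryEquiv.apply_symm_apply]
  rw [charFun_apply, integral_map (by fun_prop) (by fun_prop)]
  simp_rw [h]
  rw [← charFun_apply, charFun_multivariateGaussian_smul_one,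
    charFun_multivariateGaussian_smul_one, LinearIsometryEquiv.norm_map,
    real_inner_comm, ← h, real_inner_comm]

/-- The coordinates of `N(μ, v I)` in an orthonormal basis are independent with variance `v`. -/
lemma measurePreserving_inner_multivariateGaussian
    (b : OrthonormalBasis ι ℝ (EuclideanSpace ℝ ι)) (μ : EuclideanSpace ℝ ι) (v : ℝ≥0) :
    MeasurePreserving (fun x k => ⟪b k, x⟫) (multivariateGaussian μ ((v : ℝ) • 1))
      (Measure.pi fun k => gaussianReal ⟪b k, μ⟫ v) := by
  refine ⟨by fun_prop, ?_⟩
  have h : (fun (x : EuclideanSpace ℝ ι) k => ⟪b k, x⟫) = WithLp.ofLp ∘ b.repr := by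
    ext x k; simp [b.repr_apply_apply]
  rw [h, ← Measure.map_map (by fun_prop) (by fun_prop), map_repr_multivariateGaussian]
  have h2 : b.repr μ = WithLp.toLp 2 fun k => ⟪b k, μ⟫ := by
    ext k; simp [b.repr_apply_apply]
  rw [h2, ← map_toLp_pi_gaussianReal, Measure.map_map (by fun_prop) (by fun_prop)]
  exact Measure.map_id

variable {n d : ℕ}

/-- The vector of sample means. -/
noncomputable def meanVec (Y : Data n d) : EuclideanSpace ℝ (Fin d) := WithLp.toLp 2 (popMean Y)

@[fun_prop]
lemma measurable_popMean (j : Fin d) : Measurable fun Y : Data n d => popMean Y j := by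
  unfold popMean; fun_prop

@[fun_prop]
lemma measurable_meanVec : Measurable (meanVec : Data n d → EuclideanSpace ℝ (Fin d)) := by
  have : Measurable fun Y : Data n d => popMean Y := measurable_pi_lambda _ measurable_popMean
  unfold meanVec; fun_prop

instance (μ : EuclideanSpace ℝ (Fin d)) : IsProbabilityMeasure (dataLaw n μ) := by
  unfold dataLaw; infer_instance

/-- The characteristic function at `t` factors over all observations into Gaussian ones at `t j /
n`; the `n` equal factors give the quadratic exponent `n (t j / n) ^ 2 / 2 = t j ^ 2 / (2 n)`. -/
lemma measurePreserving_meanVec (hn : n ≠ 0) (μ : EuclideanSpace ℝ (Fin d)) :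
    MeasurePreserving meanVec (dataLaw n μ)
      (multivariateGaussian μ (((n : ℝ≥0)⁻¹ : ℝ≥0) • (1 : Matrix (Fin d) (Fin d) ℝ))) := by
  refine ⟨by fun_prop, ?_⟩
  have hn0 : (n : ℂ) ≠ 0 := by exact_mod_cast hn
  have := Measure.isProbabilityMeasure_map (μ := dataLaw n μ)
    (measurable_meanVec (n := n) (d := d)).aemeasurable
  apply Measure.ext_of_charFun (E := EuclideanSpace ℝ (Fin d))
  ext t
  refine Eq.trans ?_ (charFun_multivariateGaussian_smul_one μ _ t).symm
  rw [charFun_apply, integral_map (by fun_prop) (by fun_prop)]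
  have h : ∀ Y : Data n d, Complex.exp (⟪meanVec Y, t⟫ * Complex.I) =
      ∏ i, ∏ j, Complex.exp ((t j / n : ℝ) * Y i j * Complex.I) := by
    intro Y
    simp_rw [← Complex.exp_sum]
    rw [Finset.sum_comm]
    congr 1
    simp only [meanVec, popMean, PiLp.inner_apply, RCLike.inner_apply, conj_trivial]
    push_cast
    rw [Finset.sum_mul]
    refine Finset.sum_congr rfl fun j _ => ?_
    rw [← Finset.sum_mul, ← Finset.mul_sum]
    ring
  simp_rw [h]
  unfold dataLaw
  rw [integral_fintype_prod_eq_prod (f := fun (_ : Fin n) (y : Fin d → ℝ) =>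
    ∏ j, Complex.exp ((t j / n : ℝ) * y j * Complex.I))]
  simp_rw [integral_fintype_prod_eq_prod (f := fun (j : Fin d) (y : ℝ) =>
    Complex.exp ((t j / n : ℝ) * y * Complex.I)), ← charFun_apply_real, charFun_gaussianReal]
  rw [Finset.prod_const, ← Complex.exp_sum, ← Complex.exp_nat_mul]
  congr 1
  rw [EuclideanSpace.real_norm_sq_eq, PiLp.inner_apply]
  simp only [RCLike.inner_apply, conj_trivial, Finset.card_univ, Fintype.card_fin]
  rw [Finset.sum_sub_distrib, mul_sub, Finset.mul_sum, Finset.mul_sum]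
  push_cast
  rw [Finset.sum_mul, Finset.mul_sum, Finset.sum_div]
  congr 1 <;> refine Finset.sum_congr rfl fun j _ => ?_
  · field_simp
  · field_simp

end Law

/-! ### Risk of a shrinkage estimator in an arbitrary orthonormal basis. -/

section Risk

variable {n d : ℕ} (b : OrthonormalBasis (Fin d) ℝ (EuclideanSpace ℝ (Fin d)))
  (s : Finset (Fin d))

/-- The expectation of `(∑ k ∈ s, ⟪b k, x⟫ ^ 2)⁻¹` under `N(μ, n⁻¹ I)`. -/
noncomputable def invMoment (n : ℕ) (μ : EuclideanSpace ℝ (Fin d)) : ℝ :=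
  ∫ x, (∑ k ∈ s, ⟪b k, x⟫ ^ 2)⁻¹
    ∂(multivariateGaussian μ (((n : ℝ≥0)⁻¹ : ℝ≥0) • (1 : Matrix (Fin d) (Fin d) ℝ)))

lemma natCast_inv_ne_zero (hn : n ≠ 0) : ((n : ℝ≥0)⁻¹ : ℝ≥0) ≠ 0 :=
  inv_ne_zero (by exact_mod_cast hn)

lemma invMoment_eq (μ : EuclideanSpace ℝ (Fin d)) :
    invMoment b s n μ = ∫ y, (∑ k ∈ s, y k ^ 2)⁻¹
      ∂(Measure.pi fun k => gaussianReal ⟪b k, μ⟫ (n : ℝ≥0)⁻¹) := by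
  have h := measurePreserving_inner_multivariateGaussian b μ (n : ℝ≥0)⁻¹
  rw [← h.map_eq, integral_map h.measurable.aemeasurable
    (Measurable.aestronglyMeasurable (by fun_prop))]
  rfl

lemma integrable_inv_sum_inner_sq (hn : n ≠ 0) (hs : 3 ≤ s.card)
    (μ : EuclideanSpace ℝ (Fin d)) :
    Integrable (fun x => (∑ k ∈ s, ⟪b k, x⟫ ^ 2)⁻¹)
      (multivariateGaussian μ (((n : ℝ≥0)⁻¹ : ℝ≥0) • (1 : Matrix (Fin d) (Fin d) ℝ))) :=
  (measurePreserving_inner_multivariateGaussian b μ (n : ℝ≥0)⁻¹).integrable_comp_of_integrable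
    (integrable_inv_sum_sq _ s (natCast_inv_ne_zero hn) hs)

lemma ae_sum_inner_sq_pos (hn : n ≠ 0) (hs : s.Nonempty) (μ : EuclideanSpace ℝ (Fin d)) :
    ∀ᵐ x ∂(multivariateGaussian μ (((n : ℝ≥0)⁻¹ : ℝ≥0) • (1 : Matrix (Fin d) (Fin d) ℝ))),
      0 < ∑ k ∈ s, ⟪b k, x⟫ ^ 2 :=
  (measurePreserving_inner_multivariateGaussian b μ (n : ℝ≥0)⁻¹).quasiMeasurePreserving.ae
    (ae_sum_sq_pos _ s (natCast_inv_ne_zero hn) hs)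

lemma exists_invMoment_le (hn : n ≠ 0) (hs : 3 ≤ s.card) :
    ∃ C, ∀ μ, invMoment b s n μ ≤ C :=
  ⟨_, fun μ => (invMoment_eq b s μ).trans_le
    (integral_inv_sum_sq_le _ s (natCast_inv_ne_zero hn) hs)⟩

lemma invMoment_nonneg (μ : EuclideanSpace ℝ (Fin d)) : 0 ≤ invMoment b s n μ :=
  integral_nonneg fun _ => inv_nonneg.2 (Finset.sum_nonneg fun _ _ => sq_nonneg _)

lemma multivariateGaussian_eq_map_add (μ : EuclideanSpace ℝ (Fin d))
    (S : Matrix (Fin d) (Fin d) ℝ) :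
    multivariateGaussian μ S = (multivariateGaussian 0 S).map (μ + ·) := by
  rw [multivariateGaussian, multivariateGaussian, Measure.map_map (by fun_prop) (by fun_prop)]
  simp [Function.comp_def]

/-- Translation moves `μ` from the measure into the integrand, leaving an integral with a parameter
against a fixed measure. -/
lemma measurable_invMoment : Measurable (invMoment b s n) := by
  have : invMoment b s n = fun μ => ∫ x, (∑ k ∈ s, ⟪b k, μ + x⟫ ^ 2)⁻¹
      ∂(multivariateGaussian 0 (((n : ℝ≥0)⁻¹ : ℝ≥0) • (1 : Matrix (Fin d) (Fin d) ℝ))) := by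
    ext μ
    rw [invMoment, multivariateGaussian_eq_map_add, integral_map (by fun_prop)
      (Measurable.aestronglyMeasurable (by fun_prop))]
  rw [this]
  have hm : StronglyMeasurable fun p : EuclideanSpace ℝ (Fin d) × EuclideanSpace ℝ (Fin d) =>
      (∑ k ∈ s, ⟪b k, p.1 + p.2⟫ ^ 2)⁻¹ := Measurable.stronglyMeasurable (by fun_prop)
  exact hm.integral_prod_right'.measurable

lemma integrable_invMoment (hn : n ≠ 0) (hs : 3 ≤ s.card)
    (G : Measure (EuclideanSpace ℝ (Fin d))) [IsFiniteMeasure G] :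
    Integrable (invMoment b s n) G := by
  obtain ⟨C, hC⟩ := exists_invMoment_le b s hn hs
  refine (integrable_const C).mono' (measurable_invMoment b s).aestronglyMeasurable
    (ae_of_all _ fun μ => ?_)
  rw [Real.norm_of_nonneg (invMoment_nonneg b s μ)]
  exact hC μ

variable {est : Data n d → EuclideanSpace ℝ (Fin d)}

/-- `est` is the James–Stein estimator that shrinks the sample mean along `b k`, `k ∈ s`. -/
def IsShrinkage (est : Data n d → EuclideanSpace ℝ (Fin d)) : Prop :=
  ∀ Y k, ⟪b k, est Y⟫ = ⟪b k, meanVec Y⟫ - if k ∈ s then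
    ((n : ℝ)⁻¹ * (s.card - 2)) / (∑ j ∈ s, ⟪b j, meanVec Y⟫ ^ 2) * ⟪b k, meanVec Y⟫ else 0

variable {b s}

lemma IsShrinkage.loss_eq (h : IsShrinkage b s est) (μ : EuclideanSpace ℝ (Fin d))
    (Y : Data n d) :
    loss est μ Y = ∑ k, (⟪b k, meanVec Y⟫ - (if k ∈ s then
      (((n : ℝ≥0)⁻¹ : ℝ≥0) * (s.card - 2)) / (∑ j ∈ s, ⟪b j, meanVec Y⟫ ^ 2) * ⟪b k, meanVec Y⟫
      else 0) - ⟪b k, μ⟫) ^ 2 := by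
  rw [loss, ← b.sum_sq_inner_right]
  refine Finset.sum_congr rfl fun k _ => ?_
  rw [inner_sub_right, h Y k]
  simp

lemma measurePreserving_inner_meanVec (hn : n ≠ 0) (μ : EuclideanSpace ℝ (Fin d)) :
    MeasurePreserving (fun Y k => ⟪b k, meanVec Y⟫) (dataLaw n μ)
      (Measure.pi fun k => gaussianReal ⟪b k, μ⟫ (n : ℝ≥0)⁻¹) :=
  (measurePreserving_inner_multivariateGaussian b μ (n : ℝ≥0)⁻¹).comp
    (measurePreserving_meanVec hn μ)

lemma IsShrinkage.integrable_loss (h : IsShrinkage b s est) (hn : n ≠ 0) (hs : 3 ≤ s.card)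
    (μ : EuclideanSpace ℝ (Fin d)) : Integrable (loss est μ) (dataLaw n μ) := by
  rw [funext (h.loss_eq μ)]
  exact (measurePreserving_inner_meanVec hn μ).integrable_comp_of_integrable
    (integrable_sum_shrink_sub_sq (fun k => ⟪b k, μ⟫) s (natCast_inv_ne_zero hn) hs
      (((n : ℝ≥0)⁻¹ : ℝ≥0) * (s.card - 2)))

lemma IsShrinkage.risk_eq (h : IsShrinkage b s est) (hn : n ≠ 0) (hs : 3 ≤ s.card)
    (μ : EuclideanSpace ℝ (Fin d)) :
    risk est μ = d / n - ((n : ℝ)⁻¹ * (s.card - 2)) ^ 2 * invMoment b s n μ := by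
  have hp := measurePreserving_inner_meanVec (b := b) hn μ
  have hi := integral_sum_shrink_sub_sq (fun k => ⟪b k, μ⟫) s (natCast_inv_ne_zero hn) hs
  rw [← invMoment_eq, ← hp.map_eq, integral_map hp.measurable.aemeasurable] at hi
  · rw [risk, funext (h.loss_eq μ)]
    refine hi.trans ?_
    simp [div_eq_mul_inv]
  · rw [hp.map_eq]
    exact (integrable_sum_shrink_sub_sq (fun k => ⟪b k, μ⟫) s (natCast_inv_ne_zero hn) hs
      _).aestronglyMeasurable

lemma IsShrinkage.finiteIntegratedRisk (h : IsShrinkage b s est) (hn : n ≠ 0)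
    (hs : 3 ≤ s.card) (G : Measure (EuclideanSpace ℝ (Fin d))) [IsFiniteMeasure G] :
    FiniteIntegratedRisk est G := by
  refine ⟨h.integrable_loss hn hs, ?_⟩
  rw [funext (h.risk_eq hn hs)]
  exact (integrable_const _).sub ((integrable_invMoment b s hn hs G).const_mul _)

lemma IsShrinkage.integratedRisk_eq (h : IsShrinkage b s est) (hn : n ≠ 0)
    (hs : 3 ≤ s.card) (G : Measure (EuclideanSpace ℝ (Fin d))) [IsProbabilityMeasure G] :
    integratedRisk est G =
      d / n - ((n : ℝ)⁻¹ * (s.card - 2)) ^ 2 * ∫ μ, invMoment b s n μ ∂G := by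
  rw [integratedRisk, funext (h.risk_eq hn hs), integral_sub (integrable_const _)
    ((integrable_invMoment b s hn hs G).const_mul _), integral_const_mul]
  simp

end Risk

/-! ### Laplace transforms of Gaussian quadratic forms. -/

section QuadraticForm

variable {ι : Type*} [Fintype ι] [DecidableEq ι]

lemma dotProduct_mulVec_eq_sum_eigenvalues {A : Matrix ι ι ℝ} (hA : A.IsHermitian)
    (x : EuclideanSpace ℝ ι) :
    x ⬝ᵥ A *ᵥ x = ∑ i, hA.eigenvalues i * ⟪hA.eigenvectorBasis i, x⟫ ^ 2 := by
  rw [← Matrix.inner_toEuclideanCLM, ← hA.eigenvectorBasis.sum_inner_mul_inner]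
  refine Finset.sum_congr rfl fun i _ => ?_
  have h : ⟪hA.eigenvectorBasis i, Matrix.toEuclideanCLM (𝕜 := ℝ) A x⟫ =
      hA.eigenvalues i * ⟪hA.eigenvectorBasis i, x⟫ := by
    rw [Matrix.inner_toEuclideanCLM, Matrix.dotProduct_mulVec, ← Matrix.mulVec_transpose,
      ← Matrix.conjTranspose_eq_transpose_of_trivial, hA.eq, hA.mulVec_eigenvectorBasis,
      smul_dotProduct, EuclideanSpace.inner_eq_star_dotProduct, dotProduct_comm]
    simp
  rw [h, real_inner_comm]
  ring

lemma det_one_add_smul_eq_prod_eigenvalues {A : Matrix ι ι ℝ} (hA : A.IsHermitian) (c : ℝ) :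
    (1 + c • A).det = ∏ i, (1 + c * hA.eigenvalues i) := by
  have hU : (star hA.eigenvectorUnitary : Matrix ι ι ℝ) * (hA.eigenvectorUnitary : Matrix ι ι ℝ) =
      1 := Unitary.coe_star_mul_self _
  conv_lhs => rw [hA.spectral_theorem, Unitary.conjStarAlgAut_apply, ← Matrix.smul_mul]
  rw [Matrix.det_one_add_mul_comm, Matrix.mul_smul, ← Matrix.mul_assoc, hU, Matrix.one_mul,
    ← Matrix.diagonal_one, ← Matrix.diagonal_smul, Matrix.diagonal_add, Matrix.det_diagonal]
  rfl

/-- The Laplace transform of a quadratic form under the standard Gaussian distribution. -/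
lemma integral_exp_neg_quadratic_stdGaussian {A : Matrix ι ι ℝ} (hA : A.PosSemidef) {t : ℝ}
    (ht : 0 ≤ t) :
    ∫ x : EuclideanSpace ℝ ι, Real.exp (-(t * (x ⬝ᵥ A *ᵥ x))) ∂(stdGaussian _) =
      (√(1 + (2 * t) • A).det)⁻¹ := by
  -- In an eigenbasis of `A` the coordinates are independent standard Gaussians, so the integral is
  -- a product over the eigenvalues.
  have hb := measurePreserving_inner_multivariateGaussian hA.1.eigenvectorBasis 0 1
  have h1 : multivariateGaussian (0 : EuclideanSpace ℝ ι) (((1 : ℝ≥0) : ℝ) • 1) =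
      stdGaussian (EuclideanSpace ℝ ι) := by simp
  rw [h1] at hb
  have hx : ∀ x : EuclideanSpace ℝ ι, Real.exp (-(t * (x ⬝ᵥ A *ᵥ x))) =
      ∏ i, Real.exp (-(t * hA.1.eigenvalues i * ⟪hA.1.eigenvectorBasis i, x⟫ ^ 2)) := by
    intro x
    rw [dotProduct_mulVec_eq_sum_eigenvalues hA.1, ← Real.exp_sum, Finset.mul_sum,
      ← Finset.sum_neg_distrib]
    simp_rw [mul_assoc]
  simp_rw [hx]
  have h2 := integral_map (μ := stdGaussian (EuclideanSpace ℝ ι)) hb.measurable.aemeasurable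
    (f := fun y : ι → ℝ => ∏ i, Real.exp (-(t * hA.1.eigenvalues i * y i ^ 2)))
    (Measurable.aestronglyMeasurable (by fun_prop))
  rw [← h2, hb.map_eq, integral_fintype_prod_eq_prod
    (f := fun i (x : ℝ) => Real.exp (-(t * hA.1.eigenvalues i * x ^ 2))),
    det_one_add_smul_eq_prod_eigenvalues hA.1, Real.sqrt_prod _ fun i _ => by
      have := hA.eigenvalues_nonneg i
      positivity, ← Finset.prod_inv_distrib]
  refine Finset.prod_congr rfl fun i _ => ?_
  rw [integral_exp_neg_mul_sq_gaussianReal _ one_ne_zero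
    (mul_nonneg ht (hA.eigenvalues_nonneg i))]
  simp [mul_assoc]

/-- The Laplace transform of a quadratic form under a centred Gaussian distribution. -/
lemma integral_exp_neg_quadratic_multivariateGaussian {M V : Matrix ι ι ℝ} (hM : M.PosSemidef)
    (hV : V.PosSemidef) {t : ℝ} (ht : 0 ≤ t) :
    ∫ x : EuclideanSpace ℝ ι, Real.exp (-(t * (x ⬝ᵥ M *ᵥ x))) ∂(multivariateGaussian 0 V) =
      (√(1 + (2 * t) • (M * V)).det)⁻¹ := by
  -- `N(0, V)` is the image of the standard Gaussian under `√V`, which replaces `M` by `√V M √V`;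
  -- `det (1 + A B) = det (1 + B A)` then restores `M V`.
  set R := CFC.sqrt V with hR
  have hRR : R * R = V := CFC.sqrt_mul_sqrt_self _ hV.nonneg
  have hRh : Rᴴ = R := (CFC.sqrt_nonneg V).isSelfAdjoint
  have hRt : Rᵀ = R := by rw [← Matrix.conjTranspose_eq_transpose_of_trivial, hRh]
  have hA : (R * M * R).PosSemidef := by
    have := hM.conjTranspose_mul_mul_same R
    rwa [hRh] at this
  have hq : Measurable fun x : EuclideanSpace ℝ ι => x ⬝ᵥ M *ᵥ x := by
    simp_rw [← Matrix.inner_toEuclideanCLM]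
    fun_prop
  rw [multivariateGaussian, integral_map (by fun_prop)
    (Measurable.aestronglyMeasurable (by fun_prop))]
  have h : ∀ x : EuclideanSpace ℝ ι,
      (0 + Matrix.toEuclideanCLM (𝕜 := ℝ) R x : EuclideanSpace ℝ ι) ⬝ᵥ M *ᵥ
        (0 + Matrix.toEuclideanCLM (𝕜 := ℝ) R x : EuclideanSpace ℝ ι) =
      x ⬝ᵥ (R * M * R) *ᵥ x := by
    intro x
    rw [zero_add, Matrix.ofLp_toEuclideanCLM, ← Matrix.mulVec_mulVec, ← Matrix.mulVec_mulVec,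
      Matrix.dotProduct_mulVec (x : ι → ℝ) R, ← Matrix.mulVec_transpose, hRt]
  simp_rw [← hR, h]
  rw [integral_exp_neg_quadratic_stdGaussian hA ht, ← hRR, Matrix.mul_assoc, ← Matrix.mul_smul,
    Matrix.det_one_add_mul_comm, Matrix.smul_mul, Matrix.mul_assoc]

end QuadraticForm

/-! ### Averaging over the means and passing to `[0, 1]`. -/

section Marginal

variable {n d : ℕ} {b : OrthonormalBasis (Fin d) ℝ (EuclideanSpace ℝ (Fin d))}
  {s : Finset (Fin d)}

lemma multivariateGaussian_conv {ι : Type*} [Fintype ι] [DecidableEq ι] {S T : Matrix ι ι ℝ}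
    (hS : S.PosSemidef) (hT : T.PosSemidef) (μ ν : EuclideanSpace ℝ ι) :
    multivariateGaussian μ S ∗ multivariateGaussian ν T =
      multivariateGaussian (μ + ν) (S + T) := by
  apply Measure.ext_of_charFun
  ext t
  rw [charFun_conv, charFun_multivariateGaussian hS, charFun_multivariateGaussian hT,
    charFun_multivariateGaussian (hS.add hT), ← Complex.exp_add, inner_add_right,
    Matrix.add_mulVec, dotProduct_add]
  congr 1
  push_cast
  ring

/-- Averaging `N(μ, I / n)` over `μ ∼ N(0, S)` is a convolution, so the sample mean has law `N(0, S
+ I / n)`. Working in `ℝ≥0∞` lets Tonelli exchange the integrals without integrability. -/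
lemma lintegral_inv_eq_lintegral_laplace {M S : Matrix (Fin d) (Fin d) ℝ} (hS : S.PosSemidef)
    (hM : M.PosSemidef) (hq : ∀ x, ∑ k ∈ s, ⟪b k, x⟫ ^ 2 = x ⬝ᵥ M *ᵥ x) (hn : n ≠ 0)
    (hs : 3 ≤ s.card) :
    ∫⁻ μ, ENNReal.ofReal (invMoment b s n μ) ∂(multivariateGaussian 0 S) =
      ∫⁻ t in Set.Ioi (0 : ℝ),
        ENNReal.ofReal (√(1 + (2 * t) • (M * (S + (n : ℝ)⁻¹ • 1))).det)⁻¹ := by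
  have hne : s.Nonempty := Finset.card_pos.1 (by omega)
  have hv : (((n : ℝ≥0)⁻¹ : ℝ≥0) : ℝ) = (n : ℝ)⁻¹ := by simp
  have hT := posSemidef_smul_one (ι := Fin d) (n : ℝ≥0)⁻¹
  set T : Matrix (Fin d) (Fin d) ℝ := (((n : ℝ≥0)⁻¹ : ℝ≥0) : ℝ) • 1 with hTdef
  set φ : EuclideanSpace ℝ (Fin d) → ℝ≥0∞ := fun x =>
    ∫⁻ t in Set.Ioi (0 : ℝ), ENNReal.ofReal (Real.exp (-(t * ∑ k ∈ s, ⟪b k, x⟫ ^ 2))) with hφ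
  have hm : Measurable fun p : EuclideanSpace ℝ (Fin d) × ℝ =>
      ENNReal.ofReal (Real.exp (-(p.2 * ∑ k ∈ s, ⟪b k, p.1⟫ ^ 2))) := by fun_prop
  have hφm : Measurable φ := hm.lintegral_prod_right'
  have h1 : ∀ μ, ENNReal.ofReal (invMoment b s n μ) =
      ∫⁻ x, φ (μ + x) ∂(multivariateGaussian 0 T) := by
    intro μ
    rw [invMoment, ofReal_integral_eq_lintegral_ofReal (integrable_inv_sum_inner_sq b s hn hs μ)
      (ae_of_all _ fun x => inv_nonneg.2 (Finset.sum_nonneg fun _ _ => sq_nonneg _))]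
    have h2 : ∫⁻ x, ENNReal.ofReal (∑ k ∈ s, ⟪b k, x⟫ ^ 2)⁻¹ ∂(multivariateGaussian μ T) =
        ∫⁻ x, φ x ∂(multivariateGaussian μ T) := by
      refine lintegral_congr_ae ?_
      filter_upwards [ae_sum_inner_sq_pos b s hn hne μ] with x hx
      rw [← integral_exp_neg_mul_Ioi hx,
        ofReal_integral_eq_lintegral_ofReal (integrableOn_exp_neg_mul_Ioi hx)
          (ae_of_all _ fun _ => (Real.exp_pos _).le)]
    refine h2.trans ?_
    rw [multivariateGaussian_eq_map_add, lintegral_map hφm (by fun_prop)]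
  simp_rw [h1]
  rw [← Measure.lintegral_conv hφm, multivariateGaussian_conv hS hT, add_zero, ← hv, ← hTdef,
    hφ, lintegral_lintegral_swap hm.aemeasurable]
  refine setLIntegral_congr_fun measurableSet_Ioi fun t ht => ?_
  have ht0 : (0 : ℝ) ≤ t := le_of_lt ht
  rw [← integral_exp_neg_quadratic_multivariateGaussian hM (hS.add hT) ht0,
    ofReal_integral_eq_lintegral_ofReal _ (ae_of_all _ fun _ => (Real.exp_pos _).le)]
  · simp_rw [hq]
  · simp_rw [← hq]
    refine (integrable_const (1 : ℝ)).mono' (Measurable.aestronglyMeasurable (by fun_prop))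
      (ae_of_all _ fun x => ?_)
    rw [Real.norm_of_nonneg (Real.exp_pos _).le, Real.exp_le_one_iff, neg_nonpos]
    exact mul_nonneg ht0 (Finset.sum_nonneg fun _ _ => sq_nonneg _)

/-- The substitution `t = a (1 - u) / (2 u)`, with inverse `u = a / (a + 2 t)`. For `a = n` it gives
`2 t / n = (1 - u) / u`, and `u (1 + ((1 - u) / u) (1 + n λ)) = 1 + n (1 - u) λ`. -/
lemma lintegral_Ioi_eq_lintegral_Ioo {a : ℝ} (ha : 0 < a) (f : ℝ → ℝ≥0∞) :
    ∫⁻ t in Set.Ioi (0 : ℝ), f t = ∫⁻ u in Set.Ioo (0 : ℝ) 1,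
      ENNReal.ofReal (a / (2 * u ^ 2)) * f (a * (1 - u) / (2 * u)) := by
  have himg : (fun u : ℝ => a * (1 - u) / (2 * u)) '' Set.Ioo 0 1 = Set.Ioi 0 := by
    ext t
    simp only [Set.mem_image, Set.mem_Ioo, Set.mem_Ioi]
    constructor
    · rintro ⟨u, ⟨h0, h1⟩, rfl⟩
      have : 0 < 1 - u := by linarith
      positivity
    · intro ht
      refine ⟨a / (a + 2 * t), ⟨by positivity, ?_⟩, ?_⟩
      · rw [div_lt_one (by positivity)]; linarith
      · field_simp; ring
  have hd : ∀ u ∈ Set.Ioo (0 : ℝ) 1, HasDerivWithinAt (fun u : ℝ => a * (1 - u) / (2 * u))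
      (-(a / (2 * u ^ 2))) (Set.Ioo 0 1) u := by
    intro u hu
    have hu0 : u ≠ 0 := hu.1.ne'
    have := (((hasDerivAt_id u).const_sub 1).const_mul a).div ((hasDerivAt_id u).const_mul 2)
      (by simpa using hu0)
    refine (this.congr_deriv ?_).hasDerivWithinAt
    simp only [id]
    field_simp
    ring
  have hinj : Set.InjOn (fun u : ℝ => a * (1 - u) / (2 * u)) (Set.Ioo 0 1) := by
    intro u hu w hw h
    have hu0 : u ≠ 0 := hu.1.ne'
    have hw0 : w ≠ 0 := hw.1.ne'
    simp only at h
    rw [div_eq_div_iff (by positivity) (by positivity)] at h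
    have : a * (w - u) = 0 := by linarith
    rcases mul_eq_zero.1 this with h | h <;> linarith
  rw [← himg, lintegral_image_eq_lintegral_abs_deriv_mul measurableSet_Ioo hd hinj]
  refine setLIntegral_congr_fun measurableSet_Ioo fun u hu => ?_
  rw [abs_neg, abs_of_nonneg (by positivity)]

/-- The power has exponent greater than `-1`, and the other factor is continuous on the closed
interval. -/
lemma intervalIntegrable_rpow_div_sqrt {r : ℝ} (hr : 0 < r) {ξ : ℝ → ℝ} (hξ : ContinuousOn ξ (Set.Icc 0 1))
    (hpos : ∀ u ∈ Set.Icc (0 : ℝ) 1, 0 < ξ u) :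
    IntervalIntegrable (fun u : ℝ => u ^ (r / 2 - 1) / √(ξ u)) volume 0 1 := by
  simp_rw [div_eq_mul_inv (_ ^ _)]
  refine (intervalIntegral.intervalIntegrable_rpow' (by linarith)).mul_continuousOn ?_
  rw [Set.uIcc_of_le zero_le_one]
  exact hξ.sqrt.inv₀ fun u hu => (Real.sqrt_pos.2 (hpos u hu)).ne'

/-- The integrated inverse moment as an integral over `[0, 1]`. -/
lemma integral_invMoment_eq {M S : Matrix (Fin d) (Fin d) ℝ} (hS : S.PosSemidef)
    (hM : M.PosSemidef) (hq : ∀ x, ∑ k ∈ s, ⟪b k, x⟫ ^ 2 = x ⬝ᵥ M *ᵥ x) (hn : n ≠ 0)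
    (hs : 3 ≤ s.card) {ξ : ℝ → ℝ} (hξ : ContinuousOn ξ (Set.Icc 0 1))
    (hpos : ∀ u ∈ Set.Icc (0 : ℝ) 1, 0 < ξ u)
    (hdet : ∀ u ∈ Set.Ioo (0 : ℝ) 1,
      u ^ s.card * (1 + ((1 - u) / u) • (M * (1 + (n : ℝ) • S))).det = ξ u) :
    ∫ μ, invMoment b s n μ ∂(multivariateGaussian 0 S) =
      n / 2 * ∫ u in (0 : ℝ)..1, u ^ (((s.card : ℝ) - 2) / 2 - 1) / √(ξ u) := by
  have hn0 : (0 : ℝ) < n := by positivity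
  have hr : (0 : ℝ) < (s.card : ℝ) - 2 := by
    have : (3 : ℝ) ≤ s.card := by exact_mod_cast hs
    linarith
  have hnonneg : ∀ u ∈ Set.Ioo (0 : ℝ) 1,
      0 ≤ n / 2 * (u ^ (((s.card : ℝ) - 2) / 2 - 1) / √(ξ u)) := fun u hu => by
    have := hu.1
    positivity
  have hint : IntegrableOn (fun u : ℝ => n / 2 * (u ^ (((s.card : ℝ) - 2) / 2 - 1) / √(ξ u)))
      (Set.Ioo 0 1) := by
    have := (intervalIntegrable_rpow_div_sqrt hr hξ hpos).const_mul (n / 2 : ℝ)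
    rwa [intervalIntegrable_iff_integrableOn_Ioo_of_le zero_le_one] at this
  have h1 := lintegral_inv_eq_lintegral_laplace hS hM hq hn hs
  rw [lintegral_Ioi_eq_lintegral_Ioo hn0, ← ofReal_integral_eq_lintegral_ofReal
    (integrable_invMoment b s hn hs _) (ae_of_all _ fun μ => invMoment_nonneg b s μ)] at h1
  have h2 : ∫⁻ u in Set.Ioo (0 : ℝ) 1, ENNReal.ofReal (n / (2 * u ^ 2)) *
      ENNReal.ofReal (√(1 + (2 * (n * (1 - u) / (2 * u))) • (M * (S + (n : ℝ)⁻¹ • 1))).det)⁻¹ =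
      ∫⁻ u in Set.Ioo (0 : ℝ) 1,
        ENNReal.ofReal (n / 2 * (u ^ (((s.card : ℝ) - 2) / 2 - 1) / √(ξ u))) := by
    refine setLIntegral_congr_fun measurableSet_Ioo fun u hu => ?_
    have hu0 : 0 < u := hu.1
    rw [← ENNReal.ofReal_mul (by positivity)]
    congr 1
    have e1 : (2 * (n * (1 - u) / (2 * u))) • (M * (S + (n : ℝ)⁻¹ • 1)) =
        ((1 - u) / u) • (M * (1 + (n : ℝ) • S)) := by
      have : (1 + (n : ℝ) • S) = (n : ℝ) • (S + (n : ℝ)⁻¹ • 1) := by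
        rw [smul_add, smul_smul, mul_inv_cancel₀ hn0.ne', one_smul, add_comm]
      rw [this, Matrix.mul_smul, smul_smul]
      congr 1
      field_simp
    have e2 : (1 + ((1 - u) / u) • (M * (1 + (n : ℝ) • S))).det = ξ u / u ^ s.card := by
      rw [← hdet u hu]; field_simp
    rw [e1, e2, Real.sqrt_div (hpos u (Set.Ioo_subset_Icc_self hu)).le, inv_div]
    -- The exponents match because `r / 2 = ((r - 2) / 2 - 1) + 2`; the `u ^ 2` cancels against the
    -- Jacobian `n / (2 u ^ 2)`.
    have e3 : √(u ^ s.card) = u ^ (((s.card : ℝ) - 2) / 2 - 1) * u ^ 2 := by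
      rw [Real.sqrt_eq_rpow, ← Real.rpow_natCast, ← Real.rpow_mul hu0.le, ← Real.rpow_natCast u 2,
        ← Real.rpow_add hu0]
      congr 1
      push_cast
      ring
    rw [e3]
    field_simp
  rw [h2, ← ofReal_integral_eq_lintegral_ofReal hint
    (by filter_upwards [ae_restrict_mem measurableSet_Ioo] with u hu using hnonneg u hu)] at h1
  rw [ENNReal.ofReal_eq_ofReal_iff (integral_nonneg fun μ => invMoment_nonneg b s μ)
    (setIntegral_nonneg measurableSet_Ioo hnonneg)] at h1
  rw [h1, integral_const_mul, intervalIntegral.integral_of_le zero_le_one,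
    integral_Ioc_eq_integral_Ioo]

/-- The integrated risk of a James–Stein estimator under a centred Gaussian law of the means. -/
lemma IsShrinkage.integratedRisk_multivariateGaussian {est : Data n d → EuclideanSpace ℝ (Fin d)}
    (h : IsShrinkage b s est) {M S : Matrix (Fin d) (Fin d) ℝ} (hS : S.PosSemidef)
    (hM : M.PosSemidef) (hq : ∀ x, ∑ k ∈ s, ⟪b k, x⟫ ^ 2 = x ⬝ᵥ M *ᵥ x) (hn : n ≠ 0)
    (hs : 3 ≤ s.card) {ξ : ℝ → ℝ} (hξ : ContinuousOn ξ (Set.Icc 0 1))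
    (hpos : ∀ u ∈ Set.Icc (0 : ℝ) 1, 0 < ξ u)
    (hdet : ∀ u ∈ Set.Ioo (0 : ℝ) 1,
      u ^ s.card * (1 + ((1 - u) / u) • (M * (1 + (n : ℝ) • S))).det = ξ u) :
    integratedRisk est (multivariateGaussian 0 S) =
      d / n - ((s.card : ℝ) - 2) ^ 2 / (2 * n) *
        ∫ u in (0 : ℝ)..1, u ^ (((s.card : ℝ) - 2) / 2 - 1) / √(ξ u) := by
  have hn0 : (n : ℝ) ≠ 0 := by exact_mod_cast hn
  rw [h.integratedRisk_eq hn hs, integral_invMoment_eq hS hM hq hn hs hξ hpos hdet]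
  field_simp

end Marginal

/-! ### Determinants under rank-one perturbation and orthogonal conjugation. -/

section Determinant

variable {ι : Type*} [Fintype ι] [DecidableEq ι]

/-- Factoring out the diagonal matrix leaves a rank-one perturbation of the identity. -/
lemma det_diagonal_add_vecMulVec {a : ι → ℝ} (ha : ∀ j, a j ≠ 0) (x y : ι → ℝ) :
    (Matrix.diagonal a + Matrix.vecMulVec x y).det =
      (∏ j, a j) * (1 + ∑ j, x j * y j / a j) := by
  have h : Matrix.diagonal a + Matrix.vecMulVec x y =
      Matrix.diagonal a * (1 + Matrix.vecMulVec (fun j => x j / a j) y) := by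
    ext i j
    rw [Matrix.mul_add, Matrix.mul_one, Matrix.add_apply, Matrix.add_apply,
      Matrix.diagonal_mul, Matrix.vecMulVec_apply, Matrix.vecMulVec_apply]
    have := ha i
    field_simp
  rw [h, Matrix.det_mul, Matrix.det_diagonal, Matrix.vecMulVec_eq Unit,
    Matrix.det_one_add_replicateCol_mul_replicateRow]
  congr 2
  refine Finset.sum_congr rfl fun j _ => ?_
  ring

variable {P : Matrix ι ι ℝ} (hP : P ∈ Matrix.orthogonalGroup ι ℝ)

include hP

lemma transpose_mul_self_of_mem_orthogonalGroup : Pᵀ * P = 1 :=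
  (Matrix.mem_orthogonalGroup_iff' _ _).1 hP

lemma mul_transpose_self_of_mem_orthogonalGroup : P * Pᵀ = 1 :=
  (Matrix.mem_orthogonalGroup_iff _ _).1 hP

/-- Moving `P` cyclically diagonalizes the covariance at the price of replacing `M` by `Pᵀ M P`. -/
lemma det_one_add_smul_conj (M L : Matrix ι ι ℝ) (τ c : ℝ) :
    (1 + τ • (M * (1 + c • (P * L * Pᵀ)))).det =
      (1 + τ • ((Pᵀ * M * P) * (1 + c • L))).det := by
  have h1 := mul_transpose_self_of_mem_orthogonalGroup hP
  have h2 : (1 + c • (P * L * Pᵀ)) = P * (1 + c • L) * Pᵀ := by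
    rw [Matrix.mul_add, Matrix.mul_one, Matrix.add_mul, h1]
    simp [Matrix.mul_assoc]
  rw [h2, ← Matrix.mul_assoc M, ← Matrix.smul_mul, Matrix.det_one_add_mul_comm, Matrix.mul_smul]
  simp only [Matrix.mul_assoc]

lemma dotProduct_self_transpose_mulVec (x : ι → ℝ) : Pᵀ *ᵥ x ⬝ᵥ Pᵀ *ᵥ x = x ⬝ᵥ x := by
  rw [Matrix.dotProduct_mulVec, ← Matrix.mulVec_transpose, Matrix.transpose_transpose,
    Matrix.mulVec_mulVec, mul_transpose_self_of_mem_orthogonalGroup hP, Matrix.one_mulVec]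

lemma pos_of_conj_diagonal_posDef {lam : ι → ℝ}
    (h : (P * Matrix.diagonal lam * Pᵀ).PosDef) (j : ι) : 0 < lam j := by
  have h2 := transpose_mul_self_of_mem_orthogonalGroup hP
  have h3 : Pᴴ * (P * Matrix.diagonal lam * Pᵀ) * P = Matrix.diagonal lam := by
    rw [Matrix.conjTranspose_eq_transpose_of_trivial]
    calc _ = (Pᵀ * P) * Matrix.diagonal lam * (Pᵀ * P) := by simp only [Matrix.mul_assoc]
      _ = _ := by rw [h2]; simp
  have hinj : Function.Injective P.mulVec := fun x y hxy => by
    simpa [Matrix.mulVec_mulVec, h2] using congrArg (Pᵀ *ᵥ ·) hxy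
  have h4 := h.conjTranspose_mul_mul_same hinj
  rw [h3, Matrix.posDef_diagonal_iff] at h4
  exact h4 j

end Determinant

/-! ### The functions `ξ₁` and `ξ₂` as rescaled determinants. -/

section Xi

variable {n d : ℕ} {lam Z : Fin d → ℝ}

lemma one_add_mul_pos (hlam : ∀ j, 0 < lam j) {u : ℝ} (hu : u ≤ 1) (j : Fin d) :
    0 < 1 + n * (1 - u) * lam j := by
  have h1 : 0 ≤ 1 - u := by linarith
  have h2 := hlam j
  positivity

lemma xi₂_pos (hlam : ∀ j, 0 < lam j) {u : ℝ} (hu : u ≤ 1) : 0 < xi₂ n lam u :=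
  Finset.prod_pos fun j _ => one_add_mul_pos hlam hu j

lemma continuous_xi₂ : Continuous (xi₂ n lam) := by
  unfold xi₂; fun_prop

/-- Write `1` as `∑ Z j ^ 2 / d` and use `1 - c λ / (1 + c λ) = 1 / (1 + c λ)` with `c = n (1 - u)`.
Positivity is visible in this form. -/
lemma xi₁_eq (hd : d ≠ 0) (hZ : ∑ j, Z j ^ 2 = d) (hlam : ∀ j, 0 < lam j) {u : ℝ}
    (hu : u ≤ 1) :
    xi₁ n lam Z u = (∑ j, Z j ^ 2 / (1 + n * (1 - u) * lam j)) / d *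
      ∏ j, (1 + n * (1 - u) * lam j) := by
  have hd0 : (d : ℝ) ≠ 0 := by exact_mod_cast hd
  unfold xi₁
  congr 1
  have h : ∑ j, Z j ^ 2 / (1 + n * (1 - u) * lam j) =
      ∑ j, (Z j ^ 2 - n * (1 - u) * (lam j * Z j ^ 2 / (1 + n * (1 - u) * lam j))) := by
    refine Finset.sum_congr rfl fun j _ => ?_
    have := (one_add_mul_pos (n := n) hlam hu j).ne'
    field_simp
    ring
  rw [h, Finset.sum_sub_distrib, hZ, ← Finset.mul_sum]
  field_simp

lemma xi₁_pos (hd : d ≠ 0) (hZ : ∑ j, Z j ^ 2 = d) (hlam : ∀ j, 0 < lam j) {u : ℝ}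
    (hu : u ≤ 1) : 0 < xi₁ n lam Z u := by
  have hd0 : (0 : ℝ) < d := by positivity
  rw [xi₁_eq hd hZ hlam hu]
  refine mul_pos (div_pos ?_ hd0) (xi₂_pos hlam hu)
  obtain ⟨j, -, hj⟩ : ∃ j ∈ Finset.univ, (0 : ℝ) < Z j ^ 2 := by
    by_contra! h
    exact hd0.not_ge (hZ ▸ Finset.sum_nonpos h)
  exact Finset.sum_pos' (fun j _ => div_nonneg (sq_nonneg _) (one_add_mul_pos hlam hu j).le)
    ⟨j, Finset.mem_univ j, div_pos hj (one_add_mul_pos hlam hu j)⟩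

lemma continuousOn_xi₁ (hlam : ∀ j, 0 < lam j) :
    ContinuousOn (xi₁ n lam Z) (Set.Icc 0 1) := by
  unfold xi₁
  refine ContinuousOn.mul (continuousOn_const.sub (ContinuousOn.mul (by fun_prop)
    (continuousOn_finsetSum _ fun j _ => ContinuousOn.div (by fun_prop) (by fun_prop)
      fun u hu => (one_add_mul_pos hlam hu.2 j).ne'))) (by fun_prop)

lemma one_add_div_mul_eq {u : ℝ} (hu : u ≠ 0) (j : Fin d) :
    1 + (1 - u) / u * (1 + n * lam j) = (1 + n * (1 - u) * lam j) / u := by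
  field_simp; ring

lemma prod_one_add_div_mul_eq {u : ℝ} (hu : u ≠ 0) :
    ∏ j, (1 + (1 - u) / u * (1 + n * lam j)) = xi₂ n lam u / u ^ d := by
  simp_rw [one_add_div_mul_eq hu]
  rw [Finset.prod_div_distrib, xi₂]
  simp

lemma pow_mul_det_eq_xi₂ {u : ℝ} (hu : u ≠ 0) :
    u ^ d * (1 + ((1 - u) / u) • (1 * (1 + (n : ℝ) • Matrix.diagonal lam))).det =
      xi₂ n lam u := by
  have h : (1 + ((1 - u) / u) • (1 * (1 + (n : ℝ) • Matrix.diagonal lam))) =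
      Matrix.diagonal fun j => 1 + (1 - u) / u * (1 + n * lam j) := by
    ext i j
    rcases eq_or_ne i j with rfl | hij <;> simp [*, mul_add]
  rw [h, Matrix.det_diagonal, prod_one_add_div_mul_eq hu]
  field_simp

/-- The scalar in the rank-one determinant formula carries one factor `u`, reflecting that the
centring projection has rank `d - 1`; hence `u ^ (d - 1)` here against `u ^ d` for `ξ₂`. -/
lemma pow_mul_det_eq_xi₁ (hd : d ≠ 0) (hZ : ∑ j, Z j ^ 2 = d) (hlam : ∀ j, 0 < lam j) {u : ℝ}
    (hu : 0 < u) (hu1 : u ≤ 1) :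
    u ^ (d - 1) * (1 + ((1 - u) / u) • ((1 - (d : ℝ)⁻¹ • Matrix.vecMulVec Z Z) *
      (1 + (n : ℝ) • Matrix.diagonal lam))).det = xi₁ n lam Z u := by
  have hd0 : (d : ℝ) ≠ 0 := by exact_mod_cast hd
  have h : (1 + ((1 - u) / u) • ((1 - (d : ℝ)⁻¹ • Matrix.vecMulVec Z Z) *
      (1 + (n : ℝ) • Matrix.diagonal lam))) =
      Matrix.diagonal (fun j => 1 + (1 - u) / u * (1 + n * lam j)) +
        Matrix.vecMulVec (fun j => -((1 - u) / u / d) * Z j)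
          (fun j => Z j * (1 + n * lam j)) := by
    have hD : (1 + (n : ℝ) • Matrix.diagonal lam) = Matrix.diagonal fun j => 1 + n * lam j := by
      ext i j
      rcases eq_or_ne i j with rfl | hij <;> simp [*]
    rw [hD]
    ext i j
    simp only [Matrix.add_apply, Matrix.smul_apply, Matrix.mul_diagonal, Matrix.sub_apply,
      Matrix.vecMulVec_apply, smul_eq_mul]
    rcases eq_or_ne i j with rfl | hij
    · simp; ring
    · simp [hij]; ring
  have hpos := fun j => one_add_mul_pos (n := n) hlam hu1 j
  rw [h, det_diagonal_add_vecMulVec (fun j => by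
    rw [one_add_div_mul_eq hu.ne']; exact (div_pos (hpos j) hu).ne'),
    prod_one_add_div_mul_eq hu.ne', xi₁_eq hd hZ hlam hu1]
  have h2 : 1 + ∑ j, -((1 - u) / u / d) * Z j * (Z j * (1 + n * lam j)) /
      (1 + (1 - u) / u * (1 + n * lam j)) =
      u * ((∑ j, Z j ^ 2 / (1 + n * (1 - u) * lam j)) / d) := by
    -- Distributing `1` over the sum reduces the claim to a termwise identity, based on `1 + n (1 -
    -- u) λ - (1 - u) (1 + n λ) = u`.
    have h3 : (1 : ℝ) = ∑ j, Z j ^ 2 / d := by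
      rw [← Finset.sum_div, hZ, div_self hd0]
    conv_lhs => enter [1]; rw [h3]
    rw [← Finset.sum_add_distrib, Finset.sum_div, Finset.mul_sum]
    refine Finset.sum_congr rfl fun j _ => ?_
    rw [one_add_div_mul_eq hu.ne']
    have hg0 := (hpos j).ne'
    obtain ⟨g, hg⟩ : ∃ g, g = 1 + n * (1 - u) * lam j := ⟨_, rfl⟩
    rw [← hg] at hg0 ⊢
    field_simp
    rw [hg]
    ring
  rw [h2, xi₂]
  have h4 : u ^ d = u ^ (d - 1) * u := by rw [← pow_succ]; congr 1; omega
  rw [h4]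
  field_simp

end Xi

/-! ### The two estimators as shrinkage estimators. -/

section Estimators

variable {n d : ℕ}

lemma isShrinkage_estPHB :
    IsShrinkage (n := n) (EuclideanSpace.basisFun (Fin d) ℝ) Finset.univ estPHB := by
  intro Y k
  simp only [EuclideanSpace.basisFun_inner, Finset.mem_univ, if_true, Finset.card_univ,
    Fintype.card_fin, meanVec, estPHB]
  rw [← div_div, inv_mul_eq_div]
  ring

lemma sum_inner_basisFun_sq (x : EuclideanSpace ℝ (Fin d)) :
    ∑ k, ⟪EuclideanSpace.basisFun (Fin d) ℝ k, x⟫ ^ 2 =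
      x ⬝ᵥ (1 : Matrix (Fin d) (Fin d) ℝ) *ᵥ x := by
  simp_rw [EuclideanSpace.basisFun_inner]
  simp [dotProduct, pow_two]

/-- An orthonormal basis that contains the normalized vector of ones. -/
lemma exists_orthonormalBasis_const (i₀ : Fin d) :
    ∃ b : OrthonormalBasis (Fin d) ℝ (EuclideanSpace ℝ (Fin d)),
      b i₀ = WithLp.toLp 2 fun _ => (√d)⁻¹ := by
  have hd : (0 : ℝ) < d := by exact_mod_cast i₀.pos
  set w : EuclideanSpace ℝ (Fin d) := WithLp.toLp 2 fun _ => (√d)⁻¹ with hw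
  have hw1 : ‖w‖ = 1 := by
    rw [EuclideanSpace.norm_eq, hw]
    simp [Real.sq_sqrt hd.le, hd.ne']
  have hon : Orthonormal ℝ (Set.domRestrict {i₀} fun _ : Fin d => w) := by
    refine ⟨fun _ => hw1, fun i j hij => ?_⟩
    exact absurd (Subsingleton.elim i j) hij
  obtain ⟨b, hb⟩ := hon.exists_orthonormalBasis_extension_of_card_eq (by simp)
  exact ⟨b, hb i₀ rfl⟩

variable {i₀ : Fin d} {b : OrthonormalBasis (Fin d) ℝ (EuclideanSpace ℝ (Fin d))}
  (hb : b i₀ = WithLp.toLp 2 fun _ => (√d)⁻¹)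

include hb

lemma inner_const_eq (x : EuclideanSpace ℝ (Fin d)) : ⟪b i₀, x⟫ = (√d)⁻¹ * ∑ j, x j := by
  rw [hb, PiLp.inner_apply, Finset.mul_sum]
  simp [mul_comm]

/-- Parseval's identity with the component along the vector of ones removed. -/
lemma sum_erase_inner_sq (x : EuclideanSpace ℝ (Fin d)) :
    ∑ k ∈ Finset.univ.erase i₀, ⟪b k, x⟫ ^ 2 = ∑ j, x j ^ 2 - (∑ j, x j) ^ 2 / d := by
  have h := b.sum_sq_inner_right x
  rw [← Finset.add_sum_erase _ _ (Finset.mem_univ i₀), inner_const_eq hb,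
    EuclideanSpace.real_norm_sq_eq, mul_pow, inv_pow, Real.sq_sqrt (Nat.cast_nonneg d)] at h
  rw [← h]
  ring

omit hb in
lemma sum_sub_mean_sq (hd : d ≠ 0) (x : Fin d → ℝ) :
    ∑ j, (x j - (∑ k, x k) / d) ^ 2 = ∑ j, x j ^ 2 - (∑ j, x j) ^ 2 / d := by
  have hd0 : (d : ℝ) ≠ 0 := by exact_mod_cast hd
  simp_rw [sub_sq]
  rw [Finset.sum_add_distrib, Finset.sum_sub_distrib, ← Finset.sum_mul, ← Finset.mul_sum]
  simp
  field_simp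
  ring

/-- The grand mean times the vector of ones is the projection of the sample mean onto `b i₀`. The
estimator keeps it and shrinks the residual, which lives on the other `d - 1` basis vectors, whence
`(d - 1) - 2 = d - 3`. -/
lemma isShrinkage_estHB : IsShrinkage (n := n) b (Finset.univ.erase i₀) estHB := by
  have hd : d ≠ 0 := i₀.pos.ne'
  have hd0 : (0 : ℝ) < d := by positivity
  intro Y k
  set x : EuclideanSpace ℝ (Fin d) := meanVec Y with hx
  have hQ : ∑ j ∈ Finset.univ.erase i₀, ⟪b j, x⟫ ^ 2 =
      ∑ j, (popMean Y j - grandMean Y) ^ 2 := by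
    rw [sum_erase_inner_sq hb]
    exact (sum_sub_mean_sq hd (popMean Y)).symm
  have hcard : (((Finset.univ.erase i₀).card : ℕ) : ℝ) - 2 = d - 3 := by
    rw [Finset.card_erase_of_mem (Finset.mem_univ _), Finset.card_univ, Fintype.card_fin,
      Nat.cast_sub (by omega)]
    push_cast; ring
  have hest : estHB Y = x - ((n : ℝ)⁻¹ * (d - 3) / ∑ j, (popMean Y j - grandMean Y) ^ 2) •
      (x - ⟪b i₀, x⟫ • b i₀) := by
    have hg : ⟪b i₀, x⟫ * (√d)⁻¹ = grandMean Y := by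
      rw [inner_const_eq hb, grandMean, div_eq_mul_inv, mul_comm, ← mul_assoc, ← mul_inv,
        Real.mul_self_sqrt hd0.le, mul_comm]
      rfl
    ext j
    have hj : (b i₀) j = (√d)⁻¹ := by rw [hb]
    simp only [estHB, PiLp.sub_apply, PiLp.smul_apply, smul_eq_mul, hj, hg]
    have hxj : x j = popMean Y j := rfl
    rw [hxj, ← div_div, inv_mul_eq_div]
    ring
  rw [hest, hQ, hcard, inner_sub_right, inner_smul_right, inner_sub_right, inner_smul_right]
  congr 1
  rw [b.inner_eq_ite]
  by_cases hk : k = i₀ <;> simp [hk]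

lemma sum_erase_inner_sq_eq_dotProduct (x : EuclideanSpace ℝ (Fin d)) :
    ∑ k ∈ Finset.univ.erase i₀, ⟪b k, x⟫ ^ 2 =
      x ⬝ᵥ (1 - (d : ℝ)⁻¹ • Matrix.vecMulVec (fun _ => 1) (fun _ => 1) :
        Matrix (Fin d) (Fin d) ℝ) *ᵥ x := by
  rw [sum_erase_inner_sq hb, Matrix.sub_mulVec, Matrix.one_mulVec, Matrix.smul_mulVec,
    dotProduct_sub, dotProduct_smul, Matrix.dotProduct_mulVec, Matrix.vecMul_vecMulVec]
  simp only [dotProduct, mul_one, pow_two, Pi.smul_apply, smul_eq_mul, ← Finset.mul_sum]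
  ring

lemma posSemidef_centering :
    (1 - (d : ℝ)⁻¹ • Matrix.vecMulVec (fun _ => 1) (fun _ => 1) :
      Matrix (Fin d) (Fin d) ℝ).PosSemidef := by
  refine .of_dotProduct_mulVec_nonneg ?_ fun x => ?_
  · ext i j
    simp [Matrix.vecMulVec_apply, Matrix.one_apply, eq_comm]
  · have := sum_erase_inner_sq_eq_dotProduct hb (WithLp.toLp 2 x)
    simp only [star_trivial]
    exact this ▸ Finset.sum_nonneg fun _ _ => sq_nonneg _

end Estimators

end NormalMeans

/-! ### The main theorem. -/

open NormalMeans

theorem proposition2 (n d : ℕ) (hn : 1 ≤ n) (hd : 4 ≤ d)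
    (S : Matrix (Fin d) (Fin d) ℝ) (hS : S.PosDef)
    (P : Matrix (Fin d) (Fin d) ℝ) (hP : P ∈ Matrix.orthogonalGroup (Fin d) ℝ)
    (lam : Fin d → ℝ) (hPS : P * Matrix.diagonal lam * Pᵀ = S)
    (Z : Fin d → ℝ) (hZ : Z = Pᵀ *ᵥ (fun _ => 1)) :
    -- the integrands are well defined: the radicands are positive on `[0, 1]`
    (∀ u ∈ Set.Icc (0 : ℝ) 1,
      0 < NormalMeans.xi₁ n lam Z u ∧ 0 < NormalMeans.xi₂ n lam u) ∧
    -- hierarchical Bayes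
    NormalMeans.FiniteIntegratedRisk (n := n) NormalMeans.estHB (multivariateGaussian 0 S) ∧
    IntervalIntegrable
      (fun u : ℝ => u ^ (((d : ℝ) - 3) / 2 - 1) / √(NormalMeans.xi₁ n lam Z u)) volume 0 1 ∧
    NormalMeans.integratedRisk (n := n) NormalMeans.estHB (multivariateGaussian 0 S) =
      (d : ℝ) / n - ((d : ℝ) - 3) ^ 2 / (2 * n) *
        ∫ u in (0 : ℝ)..1, u ^ (((d : ℝ) - 3) / 2 - 1) / √(NormalMeans.xi₁ n lam Z u) ∧
    -- partial-hierarchical Bayes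
    NormalMeans.FiniteIntegratedRisk (n := n) NormalMeans.estPHB (multivariateGaussian 0 S) ∧
    IntervalIntegrable
      (fun u : ℝ => u ^ (((d : ℝ) - 2) / 2 - 1) / √(NormalMeans.xi₂ n lam u)) volume 0 1 ∧
    NormalMeans.integratedRisk (n := n) NormalMeans.estPHB (multivariateGaussian 0 S) =
      (d : ℝ) / n - ((d : ℝ) - 2) ^ 2 / (2 * n) *
        ∫ u in (0 : ℝ)..1, u ^ (((d : ℝ) - 2) / 2 - 1) / √(NormalMeans.xi₂ n lam u) := by
  have hn0 : n ≠ 0 := by omega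
  have hd0 : d ≠ 0 := by omega
  have hdR : (4 : ℝ) ≤ d := by exact_mod_cast hd
  have hlam : ∀ j, 0 < lam j := pos_of_conj_diagonal_posDef hP (hPS ▸ hS)
  have hZ2 : ∑ j, Z j ^ 2 = d := by
    have h := dotProduct_self_transpose_mulVec hP (fun _ : Fin d => (1 : ℝ))
    rw [← hZ] at h
    simpa [dotProduct, pow_two] using h
  have hpos₁ : ∀ u ∈ Set.Icc (0 : ℝ) 1, 0 < xi₁ n lam Z u :=
    fun u hu => xi₁_pos hd0 hZ2 hlam hu.2
  have hpos₂ : ∀ u ∈ Set.Icc (0 : ℝ) 1, 0 < xi₂ n lam u := fun u hu => xi₂_pos hlam hu.2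
  obtain ⟨b, hb⟩ := exists_orthonormalBasis_const (⟨0, by omega⟩ : Fin d)
  set s : Finset (Fin d) := Finset.univ.erase ⟨0, by omega⟩ with hsdef
  have hscard : s.card = d - 1 := by
    rw [hsdef, Finset.card_erase_of_mem (Finset.mem_univ _), Finset.card_univ, Fintype.card_fin]
  have hsR : (s.card : ℝ) - 2 = d - 3 := by
    rw [hscard, Nat.cast_sub (by omega)]; push_cast; ring
  -- This is where `4 ≤ d` is needed: one direction is not shrunk, and three must remain.
  have hs3 : 3 ≤ s.card := by omega
  have hcard : (Finset.univ : Finset (Fin d)).card = d := by simp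
  have hu3 : 3 ≤ (Finset.univ : Finset (Fin d)).card := by omega
  refine ⟨fun u hu => ⟨hpos₁ u hu, hpos₂ u hu⟩,
    (isShrinkage_estHB hb).finiteIntegratedRisk hn0 hs3 _,
    intervalIntegrable_rpow_div_sqrt (by linarith) (continuousOn_xi₁ hlam) hpos₁, ?_,
    isShrinkage_estPHB.finiteIntegratedRisk hn0 hu3 _,
    intervalIntegrable_rpow_div_sqrt (by linarith) continuous_xi₂.continuousOn hpos₂, ?_⟩
  · have h := (isShrinkage_estHB (n := n) hb).integratedRisk_multivariateGaussian hS.posSemidef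
      (posSemidef_centering hb) (sum_erase_inner_sq_eq_dotProduct hb) hn0 hs3
      (continuousOn_xi₁ hlam) hpos₁ fun u hu => ?_
    · rwa [hsR] at h
    -- Conjugation fixes the identity and sends the vector of ones to `Pᵀ 1 = Z`.
    · have hM : Pᵀ * (1 - (d : ℝ)⁻¹ • Matrix.vecMulVec (fun _ => 1) (fun _ => 1)) * P =
          1 - (d : ℝ)⁻¹ • Matrix.vecMulVec Z Z := by
        rw [Matrix.mul_sub, Matrix.sub_mul, Matrix.mul_one,
          transpose_mul_self_of_mem_orthogonalGroup hP, Matrix.mul_smul, Matrix.smul_mul,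
          Matrix.mul_vecMulVec, Matrix.vecMulVec_mul, hZ, Matrix.mulVec_transpose]
      rw [← hPS, det_one_add_smul_conj hP, hM, hscard]
      exact pow_mul_det_eq_xi₁ hd0 hZ2 hlam hu.1 hu.2.le
  · have h := (isShrinkage_estPHB (n := n)).integratedRisk_multivariateGaussian hS.posSemidef
      Matrix.PosSemidef.one sum_inner_basisFun_sq hn0 hu3
      continuous_xi₂.continuousOn hpos₂ fun u hu => ?_
    · rwa [hcard] at h
    · rw [← hPS, det_one_add_smul_conj hP, Matrix.mul_one,
        transpose_mul_self_of_mem_orthogonalGroup hP, hcard]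
      exact pow_mul_det_eq_xi₂ hu.1.ne'
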